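/- Lemma 4.1 (colour splitting). Terminology. For a graph $G$ and disjoint nonempty finite vertex sets $S,T$ write $d_G(S,T)=e_G(S,T)/(|S||T|)$, and let $G[V_1,V_2]$ denote the bipartite subgraph of $G$ between disjoint vertex sets $V_1$ and $V_2$. A bipartite graph $G$ with classes $V_1,V_2$ is $(\varepsilon,d)$-regular if $|d_G(S,T)-d|\le\varepsilon$ for all $S\subseteq V_1$, $T\subseteq V_2$ with $|S|\ge\varepsilon|V_1|$ and $|T|\ge\varepsilon|V_2|$; it is $(\varepsilon,d)$-super-regular if moreover $(d-\varepsilon)|V_{3-i}|\le d_G(v)\le(d+\varepsilon)|V_{3-i}|$ for $i\in\{1,2\}$ and all $v\in V_i$. It is lower $(\varepsilon,d)$-regular, respectively lower $(\varepsilon,d)$-super-regular, if the same holds with only the lower bounds ($d_G(S,T)\ge d-\varepsilon$ and $d_G(v)\ge(d-\varepsilon)|V_{3-i}|$) required. An edge set colouring $c\colon E(G)\to 2^C$ is $(k,\Delta)$-bounded if every $\alpha\in C$ satisfies $\alpha\in c(e)$ for at most $k$ edges $e$, and $|c(e)|\le\Delta$ for every edge $e$. For $C'\subseteq C$, $G_{C'}$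 is the graph on $V(G)$ with edge set $\{e\in E(G): c(e)\subseteq C'\}$. The hierarchy $1/n\ll\mu\ll 1/r,\varepsilon,1/t,d,1/\Delta$ means that there are increasing functions $f,g\colon(0,1]\to(0,1]$ such that the result holds for all positive integers $n,r,t,\Delta$ and all $\mu,\varepsilon,d\in(0,1]$ with $1/n\le f(\mu)$ and $\mu\le g(x)$ for each $x\in\{1/r,\varepsilon,1/t,d,1/\Delta\}$. Statement. Let $1/n\ll\mu\ll 1/r,\varepsilon,1/t,d,1/\Delta$. Suppose that $G$ is a graph with vertex partition $V(G)=V_1\,\dot\cup\,\cdots\,\dot\cup\,V_r$ and $R_S\subseteq R$ are graphs on $\{1,\dots,r\}$ such that (i) $n\le|V_i|\le 2n$ for all $i$; (ii) $G[V_i,V_j]$ is $(\varepsilon,d)$-regular for all $ij\in E(R)$; (iii) $G[V_i,V_j]$ is $(\varepsilon,d)$-super-regular for all $ij\in E(R_S)$. Let $C$ be a finite set with $|C|\le\mu^{-1.3}n$ and let $c\colon E(G)\to 2^C$ be a $(\mu n,\Delta)$-bounded edge set colouring of $G$. Then there exists a partition $(C_\ell)_{\ell=1}^{t}$ of $C$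 (classes may be empty) such that for all $\ell\in\{1,\dots,t\}$ and all $ij\in E(R)$ there is a spanning subgraph $G_\ell^{ij}\subseteq G_{C_\ell}[V_i,V_j]$ which is $(2\varepsilon,d/t^\Delta)$-regular, and which is $(2\varepsilon,d/t^\Delta)$-super-regular if $ij\in E(R_S)$. The same statement also holds with "regular" and "super-regular" replaced throughout, in hypotheses and conclusion, by "lower regular" and "lower super-regular". -/

import Mathlib

namespace ColourSplitting

open Classical in
/-- The number of neighbours of `v` in `B` in the graph `G`. -/
noncomputable def degInto {V : Type*} (G : SimpleGraph V) (v : V) (B : Finset V) : ℕ :=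
  (B.filter (fun u => G.Adj v u)).card

open Classical in
/-- The density `d_G(S,T) = e_G(S,T) / (|S||T|)` of a pair of disjoint finite vertex sets,
as a real number. -/
noncomputable def density {V : Type*} (G : SimpleGraph V) (S T : Finset V) : ℝ :=
  (G.edgeDensity S T : ℝ)

/-- The bipartite graph `G[A,B]` is `(ε,d)`-regular. Only edges of `G` between `A` and `B`
matter. -/
def IsRegular {V : Type*} (G : SimpleGraph V) (A B : Finset V) (ε d : ℝ) : Prop :=
  ∀ S T : Finset V, S ⊆ A → T ⊆ B → ε * (A.card : ℝ) ≤ (S.card : ℝ) →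
    ε * (B.card : ℝ) ≤ (T.card : ℝ) → |density G S T - d| ≤ ε

/-- The bipartite graph `G[A,B]` is lower `(ε,d)`-regular. -/
def IsLowerRegular {V : Type*} (G : SimpleGraph V) (A B : Finset V) (ε d : ℝ) : Prop :=
  ∀ S T : Finset V, S ⊆ A → T ⊆ B → ε * (A.card : ℝ) ≤ (S.card : ℝ) →
    ε * (B.card : ℝ) ≤ (T.card : ℝ) → d - ε ≤ density G S T

/-- The bipartite graph `G[A,B]` is `(ε,d)`-super-regular: it is `(ε,d)`-regular and every vertex
of one class has `(d ± ε)` times the size of the other class many neighbours there. -/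
def IsSuperRegular {V : Type*} (G : SimpleGraph V) (A B : Finset V) (ε d : ℝ) : Prop :=
  IsRegular G A B ε d ∧
  (∀ v ∈ A, (d - ε) * (B.card : ℝ) ≤ (degInto G v B : ℝ) ∧
    (degInto G v B : ℝ) ≤ (d + ε) * (B.card : ℝ)) ∧
  (∀ v ∈ B, (d - ε) * (A.card : ℝ) ≤ (degInto G v A : ℝ) ∧
    (degInto G v A : ℝ) ≤ (d + ε) * (A.card : ℝ))

/-- The bipartite graph `G[A,B]` is lower `(ε,d)`-super-regular. -/
def IsLowerSuperRegular {V : Type*} (G : SimpleGraph V) (A B : Finset V) (ε d : ℝ) : Prop :=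
  IsLowerRegular G A B ε d ∧
  (∀ v ∈ A, (d - ε) * (B.card : ℝ) ≤ (degInto G v B : ℝ)) ∧
  (∀ v ∈ B, (d - ε) * (A.card : ℝ) ≤ (degInto G v A : ℝ))

/-- An edge set colouring `c : E(G) → 2^C` is `(k,Δ)`-bounded: every colour appears on at most
`k` edges and every edge carries at most `Δ` colours. -/
def IsBounded {V C : Type*} (G : SimpleGraph V) (c : G.edgeSet → Finset C) (k : ℝ) (Δ : ℕ) :
    Prop :=
  (∀ α : C, ({e : G.edgeSet | α ∈ c e}.ncard : ℝ) ≤ k) ∧ ∀ e : G.edgeSet, (c e).card ≤ Δ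

/-- The spanning subgraph `G_{C'}` of `G` consisting of the edges `e` with `c(e) ⊆ C'`. -/
def colourSubgraph {V C : Type*} (G : SimpleGraph V) (c : G.edgeSet → Finset C)
    (C' : Finset C) : SimpleGraph V where
  Adj u v := ∃ h : s(u, v) ∈ G.edgeSet, c ⟨s(u, v), h⟩ ⊆ C'
  symm := ⟨by
    rintro u v ⟨h, hc⟩
    simp only [Sym2.eq_swap (a := v)]
    exact ⟨h, hc⟩⟩
  loopless := ⟨by
    rintro v ⟨h, -⟩
    exact G.irrefl ((SimpleGraph.mem_edgeSet G).1 h)⟩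

/-- An increasing function `(0,1] → (0,1]`, as used to make sense of a hierarchy `a ≪ b`
(which abbreviates `a ≤ f b` for a suitable such `f`). Values outside `(0,1]` are irrelevant. -/
def IsHierarchyFun (f : ℝ → ℝ) : Prop :=
  StrictMonoOn f (Set.Ioc 0 1) ∧ Set.MapsTo f (Set.Ioc 0 1) (Set.Ioc 0 1)

end ColourSplitting

/-! Assign every colour independently and uniformly to one of `t` classes. If every edge carries
exactly `Δ` colours (arranged by padding with private colours), an edge lies entirely in class `l`
with probability `t ^ (-Δ)`. It remains to make all star sizes (edges from a vertex to a part) and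
all edge counts between pairs of sets concentrate simultaneously.

Pairs of sets are easy: each fails with probability `exp (-δ ^ 2 * n / (8 * Δ * μ))` up to a
constant, and there are only exponentially many pairs. For a single star the same bound is only
about `exp (-const / μ)`, which does not beat a union bound over linearly many stars. A direct local
lemma also fails: a star may see linearly many rare colours, so it can depend on a number of stars
that grows with `n`.

The remedy is to reveal the colours of a star in dyadic blocks, the most frequent first, and to
control the increment of the conditional expectation on each block (`card_partialCount_sub_gt_le`).
The event at scale `s` depends on `O(Δ * 2 ^ s)` colours, each relevant at that scale to at most `2
^ (s + 1)` stars. Rarer colours contribute less variance, so the failure probability can decay fast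
enough for the local lemma `exp_mul_card_le_card_avoiding` with weights `4 ^ (-s)`.

The local lemma gives more than existence: in `exp_mul_card_le_card_stars_balanced` all stars are
balanced with probability at least `exp (-2 * |U|)`, where the number `|U|` of stars is at most `2 *
r ^ 2 * n`. For small `μ` this exceeds the total failure probability of the pairs, so one assignment
does both (`exists_balanced_assignment`). Regularity then transfers with relative error absorbed by
the passage from `ε` to `2 * ε`. -/

namespace ColourSplitting

/-! ### Independence of disjoint sets of coordinates -/

open Finset

/-- Functions of complementary sets of coordinates are independent under the uniform measure. -/
theorem card_mul_sum_mul_of_dependsOn {C K : Type*} [Fintype C] [DecidableEq C] [Fintype K]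
    (S : Finset C) {F G : (C → K) → ℝ} (hF : DependsOn F (S : Set C))
    (hG : DependsOn G (S : Set C)ᶜ) :
    (Fintype.card (C → K) : ℝ) * ∑ x, F x * G x = (∑ x, F x) * ∑ x, G x := by
  -- Two independent points exchange their coordinates outside `S`. Afterwards the first point alone
  -- determines both `F x` and `G y`.
  have hinv : Function.Involutive
      (fun p : (C → K) × (C → K) => (S.piecewise p.1 p.2, S.piecewise p.2 p.1)) := by
    rintro ⟨x, y⟩
    ext i <;> by_cases hi : i ∈ S <;> simp [hi]
  have h1 : ∑ p : (C → K) × (C → K), F p.1 * G p.2 =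
      ∑ p : (C → K) × (C → K), F p.1 * G p.1 := by
    refine Fintype.sum_equiv hinv.toPerm _ _ ?_
    rintro ⟨x, y⟩
    have e1 : F x = F (S.piecewise x y) := hF fun i hi => by
      simp [Finset.mem_coe.1 hi]
    have e2 : G y = G (S.piecewise x y) := hG fun i hi => by
      simp only [Set.mem_compl_iff, Finset.mem_coe] at hi
      simp [hi]
    simp only [Function.Involutive.coe_toPerm]
    rw [e1, e2]
  rw [Fintype.sum_prod_type, Fintype.sum_prod_type] at h1
  rw [Finset.sum_mul_sum, h1]
  simp [Finset.mul_sum]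

/-! ### Conditional expectations and concentration -/

section PartialCount

variable {E C : Type*} [DecidableEq C] {t : ℕ}

/-- The expected number of edges in `L` all of whose colours are assigned to `l`, when the colours
in `R` are assigned according to `x` and all others uniformly at random. -/
noncomputable def partialCount (c : E → Finset C) (l : Fin t) (L : Finset E) (R : Finset C)
    (x : C → Fin t) : ℝ :=
  ∑ e ∈ L, ∏ α ∈ c e, if α ∈ R then (if x α = l then 1 else 0) else (1 / t : ℝ)

/-- The number of edges of `L` carrying the colour `α`. -/
def multiplicity (c : E → Finset C) (L : Finset E) (α : C) : ℕ := #{e ∈ L | α ∈ c e}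

/-- The edges of `L` all of whose colours are assigned to `l` by `x`. -/
def assignedEdges (c : E → Finset C) (l : Fin t) (L : Finset E) (x : C → Fin t) : Finset E :=
  {e ∈ L | ∀ α ∈ c e, x α = l}

variable {c : E → Finset C} {l : Fin t} {L : Finset E}

theorem partialCount_dependsOn (R : Finset C) :
    DependsOn (partialCount c l L R) (R : Set C) := by
  intro x y h
  refine Finset.sum_congr rfl fun e _ => Finset.prod_congr rfl fun α _ => ?_
  by_cases hα : α ∈ R
  · simp [hα, h α hα]
  · simp [hα]

theorem partialCount_empty {Δ : ℕ} (hc : ∀ e, #(c e) = Δ) (x : C → Fin t) :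
    partialCount c l L ∅ x = #L / (t : ℝ) ^ Δ := by
  simp [partialCount, hc, div_eq_mul_inv]

theorem partialCount_eq_card (R : Finset C) (hR : ∀ e ∈ L, c e ⊆ R) (x : C → Fin t) :
    partialCount c l L R x = #(assignedEdges c l L x) := by
  rw [partialCount, assignedEdges, Finset.card_filter]
  push_cast
  refine Finset.sum_congr rfl fun e he => ?_
  have : ∀ α ∈ c e, (if α ∈ R then (if x α = l then (1 : ℝ) else 0) else (1 / t : ℝ)) =
      if x α = l then 1 else 0 := fun α hα => by simp [hR e he hα]
  rw [Finset.prod_congr rfl this, Finset.prod_ite_zero]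
  simp

theorem sum_multiplicity [Fintype C] {Δ : ℕ} (hc : ∀ e, #(c e) = Δ) :
    ∑ α, multiplicity c L α = Δ * #L := by
  simp only [multiplicity, Finset.card_filter]
  rw [Finset.sum_comm]
  simp [hc, mul_comm]

/-- The coefficient of the contribution of `α` to `partialCount`. -/
noncomputable def partialCoeff (c : E → Finset C) (l : Fin t) (L : Finset E) (R : Finset C) (α : C)
    (x : C → Fin t) : ℝ :=
  ∑ e ∈ L with α ∈ c e, ∏ β ∈ (c e).erase α,
    if β ∈ R then (if x β = l then 1 else 0) else (1 / t : ℝ)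

/-- The martingale difference for revealing `α`: a centred variable depending on `α` only, times a
coefficient independent of `α`. -/
theorem partialCount_insert {R : Finset C} {α : C} (hα : α ∉ R) (x : C → Fin t) :
    partialCount c l L (insert α R) x = partialCount c l L R x +
      ((if x α = l then 1 else 0) - 1 / t) * partialCoeff c l L R α x := by
  rw [partialCount, partialCount, partialCoeff, Finset.sum_filter, Finset.mul_sum,
    ← Finset.sum_add_distrib]
  refine Finset.sum_congr rfl fun e _ => ?_
  have hne : ∀ β ∈ (c e).erase α,
      (if β ∈ insert α R then (if x β = l then (1 : ℝ) else 0) else (1 / t : ℝ)) =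
      if β ∈ R then (if x β = l then 1 else 0) else (1 / t : ℝ) := fun β hβ => by
    simp [Finset.mem_insert, Finset.ne_of_mem_erase hβ]
  by_cases he : α ∈ c e
  · rw [← Finset.mul_prod_erase _ _ he, ← Finset.mul_prod_erase _ _ he, Finset.prod_congr rfl hne]
    simp only [Finset.mem_insert_self, if_true, hα, if_false, he]
    ring
  · have hne' := hne
    rw [Finset.erase_eq_of_notMem he] at hne'
    rw [Finset.prod_congr rfl hne']
    simp [he]

theorem abs_partialCoeff_le (R : Finset C) (α : C) (x : C → Fin t) :
    |partialCoeff c l L R α x| ≤ multiplicity c L α := by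
  have ht : (1 : ℝ) ≤ t := by exact_mod_cast l.pos
  have hf : ∀ β, 0 ≤ (if β ∈ R then (if x β = l then 1 else 0) else (1 / t : ℝ)) ∧
      (if β ∈ R then (if x β = l then 1 else 0) else (1 / t : ℝ)) ≤ 1 := fun β => by
    have h1 : (1 / t : ℝ) ≤ 1 := by rw [div_le_one (by linarith)]; exact ht
    have h0 : (0 : ℝ) ≤ 1 / t := by positivity
    split_ifs <;> constructor <;> first | assumption | norm_num
  rw [partialCoeff, abs_of_nonneg
    (Finset.sum_nonneg fun e _ => Finset.prod_nonneg fun β _ => (hf β).1), multiplicity,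
    Finset.card_eq_sum_ones]
  push_cast
  exact Finset.sum_le_sum fun e _ =>
    Finset.prod_le_one (fun β _ => (hf β).1) fun β _ => (hf β).2

theorem partialCoeff_dependsOn (R : Finset C) (α : C) :
    DependsOn (partialCoeff c l L R α) (({α} : Finset C) : Set C)ᶜ := by
  intro x y h
  refine Finset.sum_congr rfl fun e _ => Finset.prod_congr rfl fun β hβ => ?_
  have := h β (by simpa using Finset.ne_of_mem_erase hβ)
  simp [this]

/-- By convexity, the exponential on `[-|y|, |y|]` lies below its chord. -/
theorem exp_mul_le_cosh_add {z : ℝ} (hz : |z| ≤ 1) (y : ℝ) :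
    Real.exp (z * y) ≤ Real.cosh y + z * Real.sinh y := by
  have hz' := abs_le.1 hz
  have h := convexOn_exp.2 (x := y) (y := -y) (Set.mem_univ _) (Set.mem_univ _)
    (show 0 ≤ (1 + z) / 2 by linarith) (show 0 ≤ (1 - z) / 2 by linarith) (by ring)
  simp only [smul_eq_mul] at h
  have e : (1 + z) / 2 * y + (1 - z) / 2 * -y = z * y := by ring
  rw [e] at h
  rw [Real.cosh_eq, Real.sinh_eq]
  linarith

theorem sum_indicator_sub [Fintype C] (l : Fin t) (α : C) :
    ∑ x : C → Fin t, ((if x α = l then (1 : ℝ) else 0) - 1 / t) = 0 := by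
  have ht : (t : ℝ) ≠ 0 := by exact_mod_cast l.pos.ne'
  -- Transposing the labels `a` and `l` shows that all values of `x α` are equally frequent.
  have key : ∀ a : Fin t, #{x : C → Fin t | x α = a} = #{x : C → Fin t | x α = l} := by
    intro a
    refine Finset.card_bij' (fun x _ => Equiv.swap a l ∘ x) (fun x _ => Equiv.swap a l ∘ x)
      ?_ ?_ ?_ ?_
    · intro x hx; simp at hx ⊢; simp [hx]
    · intro x hx; simp at hx ⊢; simp [hx]
    · intro x _; ext i; simp
    · intro x _; ext i; simp
  have htot : Fintype.card (C → Fin t) = t * #{x : C → Fin t | x α = l} := by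
    have := Finset.card_eq_sum_card_fiberwise (f := fun x : C → Fin t => x α)
      (s := univ) (t := univ) (by intro x _; simp)
    rw [Finset.card_univ] at this
    rw [this, Finset.sum_congr rfl fun a _ => key a]
    simp
  rw [Finset.sum_sub_distrib, Finset.sum_boole, Finset.sum_const, Finset.card_univ, htot]
  simp only [nsmul_eq_mul]
  push_cast
  field_simp
  simp

/-- One Hoeffding step. After linearising the exponential, the sinh term averages to zero because
the indicator is centred and independent of `F` and `g`; the cosh term is at most `exp (a ^ 2 / 2)`.
-/
theorem sum_mul_exp_le [Fintype C] {F g : (C → Fin t) → ℝ} (l : Fin t) (α : C) (a : ℝ)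
    (hF0 : ∀ x, 0 ≤ F x)
    (hF : DependsOn F (({α} : Finset C) : Set C)ᶜ) (hg : DependsOn g (({α} : Finset C) : Set C)ᶜ)
    (hga : ∀ x, |g x| ≤ a) :
    ∑ x, F x * Real.exp (((if x α = l then 1 else 0) - 1 / t) * g x) ≤
      Real.exp (a ^ 2 / 2) * ∑ x, F x := by
  set z : (C → Fin t) → ℝ := fun x => (if x α = l then 1 else 0) - 1 / t with hz
  have ht : (1 : ℝ) ≤ t := by exact_mod_cast l.pos
  have hz1 : ∀ x, |z x| ≤ 1 := fun x => by
    have h1 : (1 / t : ℝ) ≤ 1 := by rw [div_le_one (by linarith)]; exact ht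
    have h0 : (0 : ℝ) ≤ 1 / t := by positivity
    rw [abs_le]
    simp only [hz]
    split_ifs <;> constructor <;> linarith
  have hzero : ∑ x, z x * (F x * Real.sinh (g x)) = 0 := by
    have hprod := card_mul_sum_mul_of_dependsOn {α} (F := z)
      (G := fun x => F x * Real.sinh (g x))
      (fun x y h => by simp only [hz]; rw [h α (by simp)])
      (fun x y h => by simp only; rw [hF h, hg h])
    rw [sum_indicator_sub, zero_mul] at hprod
    have : Nonempty (C → Fin t) := ⟨fun _ => l⟩
    exact (mul_eq_zero.1 hprod).resolve_left (by exact_mod_cast Fintype.card_ne_zero)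
  calc ∑ x, F x * Real.exp (z x * g x)
      ≤ ∑ x, (F x * Real.cosh (g x) + z x * (F x * Real.sinh (g x))) :=
        Finset.sum_le_sum fun x _ => by
          have := mul_le_mul_of_nonneg_left (exp_mul_le_cosh_add (hz1 x) (g x)) (hF0 x)
          linarith
    _ = ∑ x, F x * Real.cosh (g x) := by rw [Finset.sum_add_distrib, hzero, add_zero]
    _ ≤ ∑ x, F x * Real.exp (a ^ 2 / 2) := Finset.sum_le_sum fun x _ => by
          refine mul_le_mul_of_nonneg_left ((Real.cosh_le_exp_half_sq _).trans ?_) (hF0 x)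
          have := sq_le_sq' (abs_le.1 (hga x)).1 (abs_le.1 (hga x)).2
          gcongr
    _ = _ := by rw [← Finset.sum_mul, mul_comm]

/-- The colours of `B` are revealed one at a time, each costing one Hoeffding factor governed by its
multiplicity. -/
theorem sum_exp_partialCount_sub_le [Fintype C] (lam : ℝ) (R B : Finset C) (hRB : Disjoint R B) :
    ∑ x, Real.exp (lam * (partialCount c l L (R ∪ B) x - partialCount c l L R x)) ≤
      Real.exp (lam ^ 2 / 2 * ∑ α ∈ B, (multiplicity c L α : ℝ) ^ 2) *
        Fintype.card (C → Fin t) := by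
  induction B using Finset.induction_on with
  | empty => simp
  | insert α B hα ih =>
    rw [Finset.disjoint_insert_right] at hRB
    have hαR : α ∉ R ∪ B := by simp [hRB.1, hα]
    have hsub : ∀ S : Finset C, α ∉ S → (S : Set C) ⊆ (({α} : Finset C) : Set C)ᶜ := by
      intro S hS i hi
      simp only [Finset.coe_singleton, Set.mem_compl_iff, Set.mem_singleton_iff]
      rintro rfl
      exact hS hi
    have hstep := sum_mul_exp_le l α (|lam| * multiplicity c L α)
      (F := fun x => Real.exp (lam * (partialCount c l L (R ∪ B) x - partialCount c l L R x)))
      (g := fun x => lam * partialCoeff c l L (R ∪ B) α x) (fun x => (Real.exp_pos _).le)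
      (fun x y h => by
        simp only
        rw [partialCount_dependsOn (R ∪ B) fun i hi => h i (hsub _ hαR hi),
          partialCount_dependsOn R fun i hi => h i (hsub _ hRB.1 hi)])
      (fun x y h => by simp only; rw [partialCoeff_dependsOn (R ∪ B) α h])
      (fun x => by
        rw [abs_mul]
        exact mul_le_mul_of_nonneg_left (abs_partialCoeff_le _ _ _) (abs_nonneg _))
    calc _ = ∑ x, Real.exp (lam * (partialCount c l L (R ∪ B) x - partialCount c l L R x)) *
          Real.exp (((if x α = l then 1 else 0) - 1 / t) *
            (lam * partialCoeff c l L (R ∪ B) α x)) := by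
          refine Finset.sum_congr rfl fun x _ => ?_
          rw [← Real.exp_add, Finset.union_insert, partialCount_insert hαR]
          congr 1
          ring
      _ ≤ _ := hstep
      _ ≤ Real.exp ((|lam| * multiplicity c L α) ^ 2 / 2) *
          (Real.exp (lam ^ 2 / 2 * ∑ α ∈ B, (multiplicity c L α : ℝ) ^ 2) *
            Fintype.card (C → Fin t)) :=
          mul_le_mul_of_nonneg_left (ih hRB.2) (Real.exp_pos _).le
      _ = _ := by
          rw [← mul_assoc, ← Real.exp_add, Finset.sum_insert hα, mul_pow, sq_abs]
          congr 2
          ring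

/-- A bounded differences inequality for `partialCount`. -/
theorem card_partialCount_sub_gt_le [Fintype C] {lam : ℝ} (hlam : 0 < lam) (b : ℝ) (R B : Finset C)
    (hRB : Disjoint R B) :
    (#{x : C → Fin t | lam * (∑ α ∈ B, (multiplicity c L α : ℝ) ^ 2) / 2 + b / lam <
        |partialCount c l L (R ∪ B) x - partialCount c l L R x|} : ℝ) ≤
      2 * Real.exp (-b) * Fintype.card (C → Fin t) := by
  set q := ∑ α ∈ B, (multiplicity c L α : ℝ) ^ 2 with hq
  set D : (C → Fin t) → ℝ := fun x => partialCount c l L (R ∪ B) x - partialCount c l L R x with hD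
  have h1 := sum_exp_partialCount_sub_le (c := c) (l := l) (L := L) lam R B hRB
  have h2 := sum_exp_partialCount_sub_le (c := c) (l := l) (L := L) (-lam) R B hRB
  rw [neg_sq] at h2
  -- Exponential Markov inequality, with both tails handled at once.
  have h3 : (#{x : C → Fin t | lam * q / 2 + b / lam < |D x|} : ℝ) *
      Real.exp (lam ^ 2 / 2 * q + b) ≤
      ∑ x, (Real.exp (lam * D x) + Real.exp (-lam * D x)) := by
    calc _ = ∑ x with lam * q / 2 + b / lam < |D x|, Real.exp (lam ^ 2 / 2 * q + b) := by
          rw [Finset.sum_const, nsmul_eq_mul]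
      _ ≤ ∑ x with lam * q / 2 + b / lam < |D x|,
          (Real.exp (lam * D x) + Real.exp (-lam * D x)) := by
          refine Finset.sum_le_sum fun x hx => ?_
          have hx := (Finset.mem_filter.1 hx).2
          have h4 : lam ^ 2 / 2 * q + b ≤ lam * |D x| := by
            have := mul_le_mul_of_nonneg_left hx.le hlam.le
            have e : lam * (lam * q / 2 + b / lam) = lam ^ 2 / 2 * q + b := by field_simp
            linarith
          have p1 := Real.exp_pos (lam * D x)
          have p2 := Real.exp_pos (-lam * D x)
          rcases abs_cases (D x) with ⟨h, _⟩ | ⟨h, _⟩ <;> rw [h] at h4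
          · linarith [Real.exp_le_exp.2 h4]
          · have := Real.exp_le_exp.2 h4
            rw [mul_neg, ← neg_mul] at this
            linarith
      _ ≤ _ := Finset.sum_le_sum_of_subset_of_nonneg (Finset.filter_subset _ _)
          fun x _ _ => by positivity
  rw [Finset.sum_add_distrib] at h3
  have h5 : (#{x : C → Fin t | lam * q / 2 + b / lam < |D x|} : ℝ) *
      Real.exp (lam ^ 2 / 2 * q + b) ≤
      (2 * Real.exp (-b) * Fintype.card (C → Fin t)) * Real.exp (lam ^ 2 / 2 * q + b) := by
    have e : Real.exp (-b) * Real.exp (lam ^ 2 / 2 * q + b) = Real.exp (lam ^ 2 / 2 * q) := by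
      rw [← Real.exp_add]; congr 1; ring
    have e' : (2 * Real.exp (-b) * Fintype.card (C → Fin t)) * Real.exp (lam ^ 2 / 2 * q + b) =
        2 * (Real.exp (lam ^ 2 / 2 * q) * Fintype.card (C → Fin t)) := by
      rw [← e]; ring
    rw [e']
    linarith
  exact le_of_mul_le_mul_right h5 (Real.exp_pos _)

end PartialCount

/-! ### The asymmetric local lemma -/

section LocalLemma

variable {Ω I : Type*} [Fintype Ω] [DecidableEq Ω] [Fintype I] [DecidableEq I]

/-- The outcomes avoiding all events `A j` with `j ∈ J`. -/
def avoiding (A : I → Finset Ω) (J : Finset I) : Finset Ω := {ω | ∀ j ∈ J, ω ∉ A j}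

theorem card_avoiding_insert (A : I → Finset Ω) (J : Finset I) (j : I) :
    (#(avoiding A (insert j J)) : ℝ) + #(A j ∩ avoiding A J) = #(avoiding A J) := by
  have h1 : avoiding A (insert j J) = avoiding A J \ A j := by
    ext ω; simp [avoiding, and_comm]
  rw [h1, Finset.inter_comm, add_comm]
  exact_mod_cast Finset.card_inter_add_card_sdiff _ _

/-- Chain rule: the events of `K` are excluded one by one, each losing a factor of at least `1 - x
j`. -/
theorem card_avoiding_union_ge {A : I → Finset Ω} {x : I → ℝ} (hx : ∀ i, x i ≤ 1) {J : Finset I}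
    (K : Finset I) (h : ∀ K' : Finset I, ∀ j ∈ K, K' ⊆ K → j ∉ K' →
      (#(A j ∩ avoiding A (K' ∪ J)) : ℝ) ≤ x j * #(avoiding A (K' ∪ J))) :
    (∏ j ∈ K, (1 - x j)) * #(avoiding A J) ≤ (#(avoiding A (K ∪ J)) : ℝ) := by
  induction K using Finset.induction_on with
  | empty => simp
  | insert j K hj ih =>
    have ih' := ih fun K' i hi hK' hiK' =>
      h K' i (Finset.mem_insert_of_mem hi) (hK'.trans (Finset.subset_insert _ _)) hiK'
    have h1 := h K j (Finset.mem_insert_self _ _) (Finset.subset_insert _ _) hj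
    have h2 := card_avoiding_insert A (K ∪ J) j
    rw [Finset.prod_insert hj, Finset.insert_union, mul_assoc]
    have h3 := mul_le_mul_of_nonneg_left ih' (sub_nonneg.2 (hx j))
    linarith

/-- The asymmetric Lovász local lemma for the uniform measure on a finite set. -/
theorem card_avoiding_ge {A : I → Finset Ω} {x : I → ℝ} (Γ : I → Finset I)
    (hx0 : ∀ i, 0 ≤ x i) (hx1 : ∀ i, x i < 1)
    (hind : ∀ i J, Disjoint J (Γ i) →
      (Fintype.card Ω : ℝ) * #(A i ∩ avoiding A J) = #(A i) * #(avoiding A J))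
    (hA : ∀ i, (#(A i) : ℝ) ≤ x i * (∏ j ∈ Γ i, (1 - x j)) * Fintype.card Ω) :
    (∏ i, (1 - x i)) * Fintype.card Ω ≤ (#(avoiding A univ) : ℝ) := by
  -- The conditional probability of `A i`, given that all events of `J` are avoided, is at most `x
  -- i`; strong induction on the size of `J`.
  have key : ∀ m (J : Finset I), #J = m → ∀ i ∉ J,
      (#(A i ∩ avoiding A J) : ℝ) ≤ x i * #(avoiding A J) := by
    intro m
    induction m using Nat.strong_induction_on with
    | _ m ih =>
      intro J hJ i hi
      rcases isEmpty_or_nonempty Ω with hΩ | hΩ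
      · simp [Finset.eq_empty_of_isEmpty]
      have hpos : (0 : ℝ) < Fintype.card Ω := by exact_mod_cast Fintype.card_pos
      -- Independence handles `J₂`; the chain rule, fed by the induction hypothesis, bounds the cost
      -- of conditioning on `J₁` as well.
      set J₁ := J ∩ Γ i with hJ₁
      set J₂ := J \ Γ i with hJ₂
      have hun : J₁ ∪ J₂ = J := by rw [hJ₁, hJ₂, Finset.union_comm, Finset.sdiff_union_inter]
      have hmono : A i ∩ avoiding A J ⊆ A i ∩ avoiding A J₂ := by
        refine Finset.inter_subset_inter_left fun ω hω => ?_
        simp only [avoiding, Finset.mem_filter, Finset.mem_univ, true_and] at hω ⊢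
        exact fun j hj => hω j (Finset.sdiff_subset hj)
      have h1 : (#(A i ∩ avoiding A J) : ℝ) ≤ #(A i ∩ avoiding A J₂) := by
        exact_mod_cast Finset.card_le_card hmono
      have h2 : (#(A i ∩ avoiding A J₂) : ℝ) ≤
          x i * (∏ j ∈ Γ i, (1 - x j)) * #(avoiding A J₂) := by
        have h3 := hind i J₂ Finset.sdiff_disjoint
        have h4 := mul_le_mul_of_nonneg_right (hA i) (Nat.cast_nonneg (#(avoiding A J₂)))
        rw [← h3] at h4
        refine le_of_mul_le_mul_left ?_ hpos
        linarith
      have h5 : (∏ j ∈ J₁, (1 - x j)) * #(avoiding A J₂) ≤ (#(avoiding A (J₁ ∪ J₂)) : ℝ) := by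
        refine card_avoiding_union_ge (fun i => (hx1 i).le) J₁ fun K' j hj hK' hjK' => ?_
        have hjJ : j ∈ J := Finset.inter_subset_left hj
        have hj2 : j ∉ K' ∪ J₂ := by
          rw [Finset.mem_union, not_or]
          exact ⟨hjK', fun h => (Finset.mem_sdiff.1 h).2 (Finset.mem_inter.1 hj).2⟩
        have hss : K' ∪ J₂ ⊂ J := by
          refine (Finset.ssubset_iff_of_subset ?_).2 ⟨j, hjJ, hj2⟩
          rw [← hun]
          exact Finset.union_subset_union_left hK'
        exact ih _ (hJ ▸ Finset.card_lt_card hss) _ rfl j hj2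
      rw [hun] at h5
      have h6 : ∏ j ∈ Γ i, (1 - x j) ≤ ∏ j ∈ J₁, (1 - x j) :=
        by
          rw [← Finset.prod_sdiff (Finset.inter_subset_right : J₁ ⊆ Γ i)]
          exact mul_le_of_le_one_left
            (Finset.prod_nonneg fun j _ => sub_nonneg.2 (hx1 j).le)
            (Finset.prod_le_one (fun j _ => sub_nonneg.2 (hx1 j).le)
              fun j _ => by linarith [hx0 j])
      calc (#(A i ∩ avoiding A J) : ℝ) ≤ x i * ((∏ j ∈ Γ i, (1 - x j)) * #(avoiding A J₂)) := by
            linarith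
        _ ≤ x i * ((∏ j ∈ J₁, (1 - x j)) * #(avoiding A J₂)) := by
            gcongr
            exact hx0 i
        _ ≤ _ := mul_le_mul_of_nonneg_left h5 (hx0 i)
  have := card_avoiding_union_ge (A := A) (x := x) (fun i => (hx1 i).le) (J := ∅) univ
    fun K' j _ _ hj => key _ _ rfl j (by simpa using hj)
  simpa [avoiding] using this

end LocalLemma

theorem exp_neg_two_mul_le {x : ℝ} (h0 : 0 ≤ x) (h1 : x ≤ 1 / 2) : Real.exp (-(2 * x)) ≤ 1 - x := by
  rw [Real.exp_neg, inv_le_comm₀ (Real.exp_pos _) (by linarith)]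
  refine le_trans ?_ (Real.add_one_le_exp _)
  rw [inv_le_iff_one_le_mul₀ (by linarith)]
  nlinarith

theorem exp_neg_two_mul_sum_le {I : Type*} {x : I → ℝ} (h0 : ∀ i, 0 ≤ x i) (h1 : ∀ i, x i ≤ 1 / 2)
    (J : Finset I) : Real.exp (-(2 * ∑ i ∈ J, x i)) ≤ ∏ i ∈ J, (1 - x i) := by
  rw [Finset.mul_sum, ← Finset.sum_neg_distrib, Real.exp_sum]
  exact Finset.prod_le_prod (fun i _ => (Real.exp_pos _).le)
    fun i _ => exp_neg_two_mul_le (h0 i) (h1 i)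

/-- The local lemma for events determined by sets of coordinates in a product space. -/
theorem exp_mul_card_le_card_avoiding {C K I : Type*} [Fintype C] [DecidableEq C] [Fintype K]
    [DecidableEq K] [Fintype I] [DecidableEq I] (A : I → Finset (C → K)) (S : I → Finset C)
    (x : I → ℝ)
    (hS : ∀ i, DependsOn (fun ω => ω ∈ A i) (S i : Set C)) (hx0 : ∀ i, 0 ≤ x i)
    (hx1 : ∀ i, x i ≤ 1 / 2)
    (hA : ∀ i, (#(A i) : ℝ) ≤
      x i * Real.exp (-(2 * ∑ j with ¬ Disjoint (S j) (S i), x j)) * Fintype.card (C → K)) :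
    Real.exp (-(2 * ∑ i, x i)) * Fintype.card (C → K) ≤ (#(avoiding A univ) : ℝ) := by
  refine (mul_le_mul_of_nonneg_right (exp_neg_two_mul_sum_le hx0 hx1 univ)
    (Nat.cast_nonneg _)).trans ?_
  -- Events sharing no coordinate with `S i` are jointly determined off `S i`, hence independent of
  -- `A i`.
  refine card_avoiding_ge (fun i => {j | ¬ Disjoint (S j) (S i)}) hx0
    (fun i => by linarith [hx1 i]) ?_ ?_
  · intro i J hJ
    have hdis : ∀ j ∈ J, Disjoint (S j) (S i) := fun j hj => by
      by_contra h
      exact Finset.disjoint_left.1 hJ hj (by simpa using h)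
    have := card_mul_sum_mul_of_dependsOn (S i)
      (F := fun ω => if ω ∈ A i then 1 else 0) (G := fun ω => if ω ∈ avoiding A J then 1 else 0)
      (fun ω ω' h => by
        have h := hS i h
        simp only [eq_iff_iff] at h
        simp only [h])
      (fun ω ω' h => by
        have h' : ω ∈ avoiding A J ↔ ω' ∈ avoiding A J := by
          simp only [avoiding, Finset.mem_filter, Finset.mem_univ, true_and]
          refine forall₂_congr fun j hj => not_congr ?_
          have := hS j (x := ω) (y := ω') fun a ha => h a fun ha' =>
            Finset.disjoint_left.1 (hdis j hj) ha ha'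
          simpa using this
        simp only [h'])
    simp only [← ite_and, mul_ite, mul_one, mul_zero, Finset.sum_boole,
      Finset.filter_univ_mem] at this
    rw [← this]
    congr 3
    ext ω
    simp [and_comm]
  · intro i
    refine (hA i).trans ?_
    gcongr
    · exact hx0 i
    · exact exp_neg_two_mul_sum_le hx0 hx1 _

/-! ### Dyadic scales of colours -/

section Scales

variable {E C : Type*} [DecidableEq C]

/-- The dyadic scale of the colour `α` in `L`: colours of larger scale appear on fewer edges. -/
def scale (c : E → Finset C) (n : ℕ) (L : Finset E) (α : C) : ℕ :=
  Nat.log 2 (2 * n / multiplicity c L α)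

/-- The colours appearing in `L` whose scale is smaller than `s`. -/
def colsBelow [Fintype C] (c : E → Finset C) (n : ℕ) (L : Finset E) (s : ℕ) : Finset C :=
  {α | 0 < multiplicity c L α ∧ scale c n L α < s}

variable {c : E → Finset C} {n : ℕ} {L : Finset E}

theorem colsBelow_mono [Fintype C] : Monotone (colsBelow c n L) := by
  intro s s' h α hα
  simp only [colsBelow, mem_filter, mem_univ, true_and] at hα ⊢
  exact ⟨hα.1, hα.2.trans_le h⟩

theorem multiplicity_mul_two_pow_scale_le (hL : #L ≤ 2 * n) {α : C} (hα : 0 < multiplicity c L α) :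
    multiplicity c L α * 2 ^ scale c n L α ≤ 2 * n := by
  have h : 2 * n / multiplicity c L α ≠ 0 :=
    (Nat.div_pos ((Finset.card_filter_le _ _).trans hL) hα).ne'
  have := Nat.mul_le_mul_left (multiplicity c L α) (Nat.pow_log_le_self 2 h)
  exact this.trans (Nat.mul_div_le _ _)

theorem lt_multiplicity_mul_two_pow_scale {α : C} (hα : 0 < multiplicity c L α) :
    2 * n < multiplicity c L α * 2 ^ (scale c n L α + 1) := by
  have := Nat.lt_pow_succ_log_self (b := 2) (by norm_num) (2 * n / multiplicity c L α)
  rw [mul_comm (multiplicity c L α)]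
  exact (Nat.div_lt_iff_lt_mul hα).1 this

variable [Fintype C]

theorem lt_multiplicity_mul_two_pow_of_mem {s : ℕ} {α : C} (hα : α ∈ colsBelow c n L s) :
    2 * n < multiplicity c L α * 2 ^ s := by
  simp only [colsBelow, mem_filter, mem_univ, true_and] at hα
  refine (lt_multiplicity_mul_two_pow_scale hα.1).trans_le ?_
  gcongr
  · norm_num
  · exact hα.2

theorem subset_colsBelow {s : ℕ} (hs : Nat.log 2 (2 * n) < s) {e : E} (he : e ∈ L) :
    c e ⊆ colsBelow c n L s := by
  intro α hα
  simp only [colsBelow, mem_filter, mem_univ, true_and]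
  refine ⟨Finset.card_pos.2 ⟨e, by simp [he, hα]⟩, lt_of_le_of_lt ?_ hs⟩
  exact Nat.log_mono_right (Nat.div_le_self _ _)

/-- At scale `s` a multiplicity is at most `2 * n / 2 ^ s`, so the factor `2 ^ s` reduces the square
to a linear term. The linear terms telescope to the total number of colour incidences. -/
theorem sum_two_pow_mul_sq_multiplicity_le {Δ : ℕ} (hc : ∀ e, #(c e) = Δ) (hL : #L ≤ 2 * n)
    (s₀ m : ℕ) :
    ∑ i ∈ range m, (2 : ℝ) ^ (s₀ + i) *
        ∑ α ∈ colsBelow c n L (s₀ + i + 1) \ colsBelow c n L (s₀ + i), (multiplicity c L α : ℝ) ^ 2 ≤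
      Δ * (2 * n) ^ 2 := by
  have h1 : ∀ i, (2 : ℝ) ^ (s₀ + i) *
        ∑ α ∈ colsBelow c n L (s₀ + i + 1) \ colsBelow c n L (s₀ + i),
          (multiplicity c L α : ℝ) ^ 2 ≤
      (2 * n) * (∑ α ∈ colsBelow c n L (s₀ + (i + 1)), (multiplicity c L α : ℝ) -
        ∑ α ∈ colsBelow c n L (s₀ + i), (multiplicity c L α : ℝ)) := by
    intro i
    rw [← add_assoc, ← Finset.sum_sdiff (colsBelow_mono (c := c) (n := n) (L := L)
      (Nat.le_succ (s₀ + i))), add_sub_cancel_right, Finset.mul_sum, Finset.mul_sum]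
    refine Finset.sum_le_sum fun α hα => ?_
    have hα' : 0 < multiplicity c L α ∧ scale c n L α = s₀ + i := by
      simp only [colsBelow, mem_sdiff, mem_filter, mem_univ, true_and, not_and, not_lt] at hα
      exact ⟨hα.1.1, le_antisymm (by omega) (hα.2 hα.1.1)⟩
    have h := multiplicity_mul_two_pow_scale_le hL hα'.1
    rw [hα'.2] at h
    have h' : (multiplicity c L α : ℝ) * 2 ^ (s₀ + i) ≤ 2 * n := by exact_mod_cast h
    have := mul_le_mul_of_nonneg_right h' (Nat.cast_nonneg (multiplicity c L α))
    linarith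
  refine (Finset.sum_le_sum fun i _ => h1 i).trans ?_
  rw [← Finset.mul_sum, Finset.sum_range_sub
    (fun i => ∑ α ∈ colsBelow c n L (s₀ + i), (multiplicity c L α : ℝ))]
  have h2 : ∑ α ∈ colsBelow c n L (s₀ + m), (multiplicity c L α : ℝ) ≤ Δ * (2 * n) := by
    calc _ ≤ ∑ α, (multiplicity c L α : ℝ) :=
          Finset.sum_le_sum_of_subset_of_nonneg (Finset.subset_univ _)
            fun _ _ _ => Nat.cast_nonneg _
      _ = Δ * #L := by exact_mod_cast sum_multiplicity hc
      _ ≤ _ := by gcongr; exact_mod_cast hL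
  have h3 : 0 ≤ ∑ α ∈ colsBelow c n L (s₀ + 0), (multiplicity c L α : ℝ) :=
    Finset.sum_nonneg fun _ _ => Nat.cast_nonneg _
  calc _ ≤ (2 * n : ℝ) * (Δ * (2 * n)) := by gcongr; linarith
    _ = _ := by ring

theorem sum_half_pow_le (k s₀ m : ℕ) :
    ∑ i ∈ range m with k ≤ s₀ + i, (1 / 2 : ℝ) ^ (s₀ + i) ≤ 2 * (1 / 2) ^ k := by
  -- The remaining geometric tail is kept on the left so that the induction closes.
  have h : ∀ m, ∑ i ∈ range m with k ≤ s₀ + i, (1 / 2 : ℝ) ^ (s₀ + i) +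
      2 * (1 / 2) ^ (max k (s₀ + m)) ≤ 2 * (1 / 2) ^ k := by
    intro m
    induction m with
    | zero =>
      have : (1 / 2 : ℝ) ^ max k s₀ ≤ (1 / 2) ^ k :=
        pow_le_pow_of_le_one (by norm_num) (by norm_num) (le_max_left _ _)
      simpa using this
    | succ m ih =>
      rw [Finset.range_add_one, Finset.filter_insert]
      split_ifs with hk
      · rw [Finset.sum_insert (by simp)]
        rw [max_eq_right hk] at ih
        rw [max_eq_right (by omega), ← add_assoc, pow_succ]
        linarith
      · rw [max_eq_left (by omega)] at ih ⊢
        exact ih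
  have := h m
  have : (0 : ℝ) ≤ 2 * (1 / 2) ^ (max k (s₀ + m)) := by positivity
  linarith

theorem sum_half_pow_le' (s₀ m : ℕ) :
    ∑ i ∈ range m, (1 / 2 : ℝ) ^ (s₀ + i) ≤ 2 * (1 / 2) ^ s₀ := by
  have := sum_half_pow_le s₀ s₀ m
  rwa [Finset.filter_true_of_mem (by simp)] at this

theorem sum_add_one_mul_half_pow_le (s₀ m : ℕ) :
    ∑ i ∈ range m, ((s₀ + i : ℕ) + 1 : ℝ) * (1 / 2) ^ (s₀ + i) ≤
      2 * (s₀ + 2) * (1 / 2) ^ s₀ := by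
  have h : ∑ i ∈ range m, ((s₀ + i : ℕ) + 1 : ℝ) * (1 / 2) ^ (s₀ + i) =
      2 * (s₀ + 2) * (1 / 2) ^ s₀ - 2 * ((s₀ + m : ℕ) + 2) * (1 / 2) ^ (s₀ + m) := by
    induction m with
    | zero => simp
    | succ m ih =>
      rw [Finset.sum_range_succ, ih, ← add_assoc, pow_succ]
      push_cast
      ring
  have : (0 : ℝ) ≤ 2 * ((s₀ + m : ℕ) + 2) * (1 / 2) ^ (s₀ + m) := by positivity
  linarith

/-- Double counting: a colour is counted only from its own scale on, and the resulting geometric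
series is at most `2 * multiplicity / n`. -/
theorem sum_card_colsBelow_mul_half_pow_le {Δ : ℕ} (hc : ∀ e, #(c e) = Δ) (hL : #L ≤ 2 * n)
    (hn : 0 < n) (s₀ m : ℕ) :
    ∑ i ∈ range m, (#(colsBelow c n L (s₀ + i + 1)) : ℝ) * (1 / 2) ^ (s₀ + i) ≤ 4 * Δ := by
  have hn' : (0 : ℝ) < n := by exact_mod_cast hn
  calc _ = ∑ i ∈ range m, ∑ α, if α ∈ colsBelow c n L (s₀ + i + 1) then
          (1 / 2 : ℝ) ^ (s₀ + i) else 0 := by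
        refine Finset.sum_congr rfl fun i _ => ?_
        rw [← Finset.sum_filter]
        simp
    _ = ∑ α, ∑ i ∈ range m, if α ∈ colsBelow c n L (s₀ + i + 1) then
          (1 / 2 : ℝ) ^ (s₀ + i) else 0 := Finset.sum_comm
    _ ≤ ∑ α, 2 * (multiplicity c L α : ℝ) / n := by
        refine Finset.sum_le_sum fun α _ => ?_
        by_cases hα : 0 < multiplicity c L α
        · calc _ = ∑ i ∈ range m with scale c n L α ≤ s₀ + i, (1 / 2 : ℝ) ^ (s₀ + i) := by
                rw [Finset.sum_filter]
                refine Finset.sum_congr rfl fun i _ => ?_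
                simp [colsBelow, hα]
            _ ≤ 2 * (1 / 2) ^ scale c n L α := sum_half_pow_le _ _ _
            _ ≤ _ := by
                have h := lt_multiplicity_mul_two_pow_scale (n := n) hα
                have h' : (2 * n : ℝ) < multiplicity c L α * 2 ^ (scale c n L α + 1) := by
                  exact_mod_cast h
                rw [one_div, inv_pow, le_div_iff₀ hn']
                have hp : (0 : ℝ) < 2 ^ scale c n L α := by positivity
                rw [pow_succ] at h'
                rw [← div_eq_mul_inv, div_mul_eq_mul_div, div_le_iff₀ hp]
                linarith
        · have : multiplicity c L α = 0 := by omega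
          simp [colsBelow, this]
    _ = 2 * (∑ α, multiplicity c L α : ℕ) / n := by
        push_cast
        rw [← Finset.sum_div, ← Finset.mul_sum]
    _ ≤ _ := by
        rw [sum_multiplicity hc, div_le_iff₀ hn']
        have : (#L : ℝ) ≤ 2 * n := by exact_mod_cast hL
        have := mul_le_mul_of_nonneg_left this (Nat.cast_nonneg (α := ℝ) Δ)
        push_cast
        linarith

end Scales

theorem exists_two_pow_le_lt {μ : ℝ} (h0 : 0 < μ) (h1 : μ ≤ 1) :
    ∃ s : ℕ, μ ≤ (1 / 2) ^ s ∧ (1 / 2) ^ s < 2 * μ := by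
  obtain ⟨s, hs1, hs2⟩ := exists_nat_pow_near (x := μ⁻¹) (y := 2)
    ((one_le_inv₀ h0).2 h1) (by norm_num)
  refine ⟨s, ?_, ?_⟩
  · rw [one_div, inv_pow, le_inv_comm₀ h0 (by positivity)]
    exact hs1
  · rw [one_div, inv_pow, inv_lt_comm₀ (by positivity) (by positivity), mul_inv]
    rw [pow_succ] at hs2
    linarith

/-- Gives `(s + 2) * 2 ^ (-s) = O(2 ^ (-s / 2))`, which makes the logarithmic part of the thresholds
small. -/
theorem add_two_sq_le (s : ℕ) : (s + 2) ^ 2 ≤ 5 * 2 ^ s := by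
  induction s with
  | zero => norm_num
  | succ s ih =>
    rcases Nat.lt_or_ge s 1 with h | h
    · interval_cases s; norm_num
    · rw [pow_succ 2 s]
      nlinarith

/-! ### Balancing all stars by the local lemma -/

section Stars

variable {E C U : Type*} [Fintype C] [DecidableEq C] [Fintype U]
  {c : E → Finset C} {n t Δ : ℕ} {L : U → Finset E} {μ : ℝ}

/-- Each star counted uses `α` on more than `2 * n / 2 ^ s` edges, while `α` has at most `2 * n`
incidences with stars in total. -/
theorem card_mem_colsBelow_le (hn : 0 < n) (hμ1 : μ ≤ 1) (α : C)
    (hsum : ∑ u, (multiplicity c (L u) α : ℝ) ≤ 2 * (μ * n)) (s : ℕ) :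
    (#{u | α ∈ colsBelow c n (L u) s} : ℝ) ≤ 2 ^ s := by
  have hn' : (0 : ℝ) < n := by exact_mod_cast hn
  have h1 : (#{u | α ∈ colsBelow c n (L u) s} : ℝ) * (2 * n) ≤ 2 ^ s * (2 * n) := by
    calc _ = ∑ u with α ∈ colsBelow c n (L u) s, (2 * n : ℝ) := by simp
      _ ≤ ∑ u with α ∈ colsBelow c n (L u) s, multiplicity c (L u) α * (2 : ℝ) ^ s :=
          Finset.sum_le_sum fun u hu => by
            exact_mod_cast (lt_multiplicity_mul_two_pow_of_mem (Finset.mem_filter.1 hu).2).le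
      _ ≤ ∑ u, multiplicity c (L u) α * (2 : ℝ) ^ s :=
          Finset.sum_le_sum_of_subset_of_nonneg (Finset.subset_univ _) fun _ _ _ => by positivity
      _ = 2 ^ s * ∑ u, (multiplicity c (L u) α : ℝ) := by rw [← Finset.sum_mul, mul_comm]
      _ ≤ _ := by
          gcongr
          nlinarith
  exact le_of_mul_le_mul_right h1 (by positivity)

/-- Bounds the total weight of the neighbours in the dependency graph. A colour meets at most `2 ^
(s + 1)` stars at scale `s`, so weights `4 ^ (-s)` leave a convergent geometric series. -/
theorem sum_quarter_pow_not_disjoint_le (hn : 0 < n) (hμ1 : μ ≤ 1)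
    (hsum : ∀ α, ∑ u, (multiplicity c (L u) α : ℝ) ≤ 2 * (μ * n)) (s₀ m : ℕ) (T : Finset C) :
    ∑ j : U × Fin t × Fin m with ¬ Disjoint (colsBelow c n (L j.1) (s₀ + j.2.2 + 1)) T,
      (1 / 4 : ℝ) ^ (s₀ + (j.2.2 : ℕ)) ≤ #T * (4 * t * (1 / 2) ^ s₀) := by
  have hα : ∀ α, ∑ j : U × Fin t × Fin m, (if α ∈ colsBelow c n (L j.1) (s₀ + j.2.2 + 1) then
      (1 / 4 : ℝ) ^ (s₀ + (j.2.2 : ℕ)) else 0) ≤ 4 * t * (1 / 2) ^ s₀ := by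
    intro α
    rw [Fintype.sum_prod_type]
    simp only [Fintype.sum_prod_type]
    rw [Finset.sum_comm]
    simp only [Finset.sum_const, Finset.card_univ, Fintype.card_fin, nsmul_eq_mul]
    rw [Finset.sum_comm]
    calc _ ≤ (t : ℝ) * ∑ i : Fin m, 2 * (1 / 2 : ℝ) ^ (s₀ + (i : ℕ)) := by
          gcongr with i _
          rw [← Finset.sum_filter, Finset.sum_const, nsmul_eq_mul]
          have := card_mem_colsBelow_le (L := L) hn hμ1 α (hsum α) (s₀ + i + 1)
          calc _ ≤ (2 : ℝ) ^ (s₀ + (i : ℕ) + 1) * (1 / 4) ^ (s₀ + (i : ℕ)) := by gcongr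
            _ = 2 * (2 * (1 / 4)) ^ (s₀ + (i : ℕ)) := by rw [pow_succ, mul_pow]; ring
            _ = _ := by norm_num
      _ ≤ t * (2 * (2 * (1 / 2) ^ s₀)) := by
          rw [← Finset.mul_sum, Fin.sum_univ_eq_sum_range (fun i => (1 / 2 : ℝ) ^ (s₀ + i))]
          gcongr
          exact sum_half_pow_le' _ _
      _ = _ := by ring
  calc _ ≤ ∑ j : U × Fin t × Fin m with ¬ Disjoint (colsBelow c n (L j.1) (s₀ + j.2.2 + 1)) T,
        ∑ α ∈ T, (if α ∈ colsBelow c n (L j.1) (s₀ + j.2.2 + 1) then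
          (1 / 4 : ℝ) ^ (s₀ + (j.2.2 : ℕ)) else 0) := by
        refine Finset.sum_le_sum fun j hj => ?_
        obtain ⟨α, hα1, hα2⟩ := Finset.not_disjoint_iff.1 (Finset.mem_filter.1 hj).2
        refine le_trans ?_ (Finset.single_le_sum (fun β _ => ?_) hα2)
        · simp [hα1]
        · split_ifs <;> positivity
    _ ≤ ∑ j : U × Fin t × Fin m,
        ∑ α ∈ T, (if α ∈ colsBelow c n (L j.1) (s₀ + j.2.2 + 1) then
          (1 / 4 : ℝ) ^ (s₀ + (j.2.2 : ℕ)) else 0) := by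
        refine Finset.sum_le_sum_of_subset_of_nonneg (Finset.subset_univ _) fun _ _ _ =>
          Finset.sum_nonneg fun _ _ => ?_
        split_ifs <;> positivity
    _ = ∑ α ∈ T, ∑ j : U × Fin t × Fin m,
        (if α ∈ colsBelow c n (L j.1) (s₀ + j.2.2 + 1) then
          (1 / 4 : ℝ) ^ (s₀ + (j.2.2 : ℕ)) else 0) := Finset.sum_comm
    _ ≤ _ := by
        rw [← nsmul_eq_mul]
        exact Finset.sum_le_card_nsmul _ _ _ fun α _ => hα α

/-- The probability that a random assignment of the colours splits all stars evenly is not too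
small. -/
theorem exp_mul_card_le_card_stars_balanced [DecidableEq U] {δ : ℝ} (hn : 0 < n) (ht : 0 < t)
    (hΔ : 0 < Δ) (hμ0 : 0 < μ) (hδ : 0 < δ) (hc : ∀ e, #(c e) = Δ) (hL : ∀ u, #(L u) ≤ 2 * n)
    (hmult : ∀ u α, (multiplicity c (L u) α : ℝ) ≤ μ * n)
    (hsum : ∀ α, ∑ u, (multiplicity c (L u) α : ℝ) ≤ 2 * (μ * n))
    (h1 : 1152 * Δ ^ 2 * t * μ ≤ δ ^ 2) (h2 : 51840 * Δ ^ 2 * μ ≤ δ ^ 4) (h3 : 4 * t * μ ≤ 1) :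
    Real.exp (-(2 * Fintype.card U)) * Fintype.card (C → Fin t) ≤
      (#{X : C → Fin t | ∀ u l,
        |(#(assignedEdges c l (L u) X) : ℝ) - #(L u) / (t : ℝ) ^ Δ| ≤ δ * n} : ℝ) := by
  have hn' : (0 : ℝ) < n := by exact_mod_cast hn
  have ht' : (1 : ℝ) ≤ t := by exact_mod_cast ht
  have hΔ' : (0 : ℝ) < Δ := by exact_mod_cast hΔ
  have hμ1 : μ ≤ 1 / 4 := by nlinarith
  obtain ⟨s₀, hs1, hs2⟩ := exists_two_pow_le_lt hμ0 (by linarith)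
  set y : ℝ := (1 / 2) ^ s₀ with hy
  -- A colour of scale below `s₀` would have multiplicity above `2 * μ * n`; so revealing may start
  -- at `s₀`, where nothing is known.
  have hempty : ∀ u, colsBelow c n (L u) s₀ = ∅ := by
    intro u
    by_contra hne
    obtain ⟨α, hα⟩ := Finset.nonempty_iff_ne_empty.2 hne
    have h4 : (2 * n : ℝ) < multiplicity c (L u) α * 2 ^ s₀ := by
      exact_mod_cast lt_multiplicity_mul_two_pow_of_mem hα
    have h5 : μ * 2 ^ s₀ ≤ 1 := by
      rw [hy, one_div, inv_pow, le_inv_comm₀ hμ0 (by positivity)] at hs1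
      calc μ * 2 ^ s₀ ≤ μ * μ⁻¹ := by gcongr
        _ = 1 := mul_inv_cancel₀ hμ0.ne'
    have h6 : (multiplicity c (L u) α : ℝ) * 2 ^ s₀ ≤ μ * n * 2 ^ s₀ := by
      gcongr
      exact hmult u α
    nlinarith
  set m := Nat.log 2 (2 * n) + 1 with hm
  -- With this `κ` the variance terms of the thresholds sum to at most `δ * n / 3`.
  set κ : ℝ := δ / (6 * Δ) with hκ
  have hκ0 : 0 < κ := by positivity
  set lam : ℕ → ℝ := fun s => κ * 2 ^ s / n with hlam
  have hlam0 : ∀ s, 0 < lam s := fun s => by positivity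
  -- The `τ` term of `b` cancels the local lemma's loss, being twice the neighbour weight bound; the
  -- `log 4` term supplies the weight `4 ^ (-(s + 1))`.
  set τ : ℝ := 8 * t * y with hτ
  set b : U → ℕ → ℝ := fun u s => τ * #(colsBelow c n (L u) (s + 1)) + (s + 1) * Real.log 4 with hb
  set θ : U → ℕ → ℝ := fun u s => lam s * (∑ α ∈ colsBelow c n (L u) (s + 1) \
    colsBelow c n (L u) s, (multiplicity c (L u) α : ℝ) ^ 2) / 2 + b u s / lam s with hθ
  have hun : ∀ u s, colsBelow c n (L u) s ∪
      (colsBelow c n (L u) (s + 1) \ colsBelow c n (L u) s) = colsBelow c n (L u) (s + 1) :=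
    fun u s => Finset.union_sdiff_of_subset (colsBelow_mono (Nat.le_succ s))
  have hlog4 : Real.log 4 ≤ 2 := by
    rw [Real.log_le_iff_le_exp (by norm_num)]
    have := Real.add_one_le_exp 1
    have e : Real.exp 2 = Real.exp 1 * Real.exp 1 := by rw [← Real.exp_add]; norm_num
    rw [e]
    nlinarith
  have hθsum : ∀ u, ∑ i ∈ range m, θ u (s₀ + i) ≤ δ * n := by
    intro u
    have e1 := sum_two_pow_mul_sq_multiplicity_le hc (hL u) s₀ m
    have e2 := sum_card_colsBelow_mul_half_pow_le hc (hL u) hn s₀ m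
    have e3 := sum_add_one_mul_half_pow_le s₀ m
    have hexp : ∀ s, θ u s = κ / (2 * n) * (2 ^ s * ∑ α ∈ colsBelow c n (L u) (s + 1) \
        colsBelow c n (L u) s, (multiplicity c (L u) α : ℝ) ^ 2) +
        τ * n / κ * (#(colsBelow c n (L u) (s + 1)) * (1 / 2) ^ s) +
        Real.log 4 * n / κ * ((s + 1) * (1 / 2) ^ s) := by
      intro s
      simp only [hθ, hb, hlam]
      rw [one_div, inv_pow]
      field_simp
      ring
    simp only [hexp, Finset.sum_add_distrib, ← Finset.mul_sum]
    -- This quantity is only of order `√μ`, whence the fourth power of `δ` in `h2`.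
    have hyy : (s₀ + 2) * y ≤ δ ^ 2 / (72 * Δ) := by
      refine abs_le_of_sq_le_sq' ?_ (by positivity) |>.2
      have h4 : ((s₀ + 2) ^ 2 : ℝ) ≤ 5 * 2 ^ s₀ := by exact_mod_cast add_two_sq_le s₀
      have h5 : ((s₀ + 2) * y) ^ 2 ≤ 5 * y := by
        have e : (2 : ℝ) ^ s₀ * y = 1 := by rw [hy, ← mul_pow]; norm_num
        have hy0 : 0 < y := by positivity
        calc ((s₀ + 2) * y) ^ 2 = (s₀ + 2) ^ 2 * y ^ 2 := by ring
          _ ≤ 5 * 2 ^ s₀ * y ^ 2 := by gcongr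
          _ = 5 * (2 ^ s₀ * y) * y := by ring
          _ = _ := by rw [e]; ring
      rw [div_pow, le_div_iff₀ (by positivity)]
      calc _ ≤ 10 * μ * (72 * Δ) ^ 2 := by gcongr; linarith
        _ ≤ δ ^ 4 := by linarith
        _ = _ := by ring
    have g1 : κ / (2 * n) * (Δ * (2 * n) ^ 2) = δ / 3 * n := by
      rw [hκ]; field_simp; ring
    have g2 : τ * n / κ * (4 * Δ) ≤ δ / 3 * n := by
      have e : τ * n / κ * (4 * Δ) = (192 * Δ ^ 2 * t * y / δ) * n := by
        rw [hκ, hτ]; field_simp; ring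
      rw [e]
      refine mul_le_mul_of_nonneg_right ?_ hn'.le
      rw [div_le_iff₀ hδ]
      have : 192 * Δ ^ 2 * t * y ≤ 192 * Δ ^ 2 * t * (2 * μ) := by gcongr
      linarith
    have g3 : Real.log 4 * n / κ * (2 * (s₀ + 2) * y) ≤ δ / 3 * n := by
      calc Real.log 4 * n / κ * (2 * (s₀ + 2) * y) ≤ 2 * n / κ * (2 * (δ ^ 2 / (72 * Δ))) := by
            rw [mul_assoc 2 _ y]; gcongr
        _ = δ / 3 * n := by rw [hκ]; field_simp; ring
    have hl : 0 ≤ Real.log 4 := Real.log_nonneg (by norm_num)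
    have f1 := mul_le_mul_of_nonneg_left e1 (show 0 ≤ κ / (2 * n) by positivity)
    have f2 := mul_le_mul_of_nonneg_left e2 (show 0 ≤ τ * n / κ by positivity)
    have f3 := mul_le_mul_of_nonneg_left e3 (show 0 ≤ Real.log 4 * n / κ by positivity)
    linarith
  set A : U × Fin t × Fin m → Finset (C → Fin t) := fun j =>
    {X | θ j.1 (s₀ + j.2.2) <
      |partialCount c j.2.1 (L j.1) (colsBelow c n (L j.1) (s₀ + j.2.2 + 1)) X -
      partialCount c j.2.1 (L j.1) (colsBelow c n (L j.1) (s₀ + j.2.2)) X|} with hA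
  have hlll := exp_mul_card_le_card_avoiding A
    (fun j => colsBelow c n (L j.1) (s₀ + j.2.2 + 1))
    (fun j => (1 / 4 : ℝ) ^ (s₀ + (j.2.2 : ℕ)))
    (fun j X Y h => by
      have hsub := colsBelow_mono (c := c) (n := n) (L := L j.1) (Nat.le_succ (s₀ + j.2.2))
      simp only [hA, mem_filter, mem_univ, true_and]
      rw [partialCount_dependsOn (colsBelow c n (L j.1) (s₀ + j.2.2 + 1)) h,
        partialCount_dependsOn (colsBelow c n (L j.1) (s₀ + j.2.2)) fun i hi => h i (hsub hi)])
    (fun j => by positivity)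
    (fun j => by
      calc (1 / 4 : ℝ) ^ (s₀ + (j.2.2 : ℕ)) ≤ (1 / 4) ^ s₀ :=
            pow_le_pow_of_le_one (by norm_num) (by norm_num) (Nat.le_add_right _ _)
        _ ≤ y := by rw [hy]; gcongr; norm_num
        _ ≤ 1 / 2 := by linarith)
    (fun j => by
      have g1 := card_partialCount_sub_gt_le (c := c) (l := j.2.1) (L := L j.1)
        (hlam0 (s₀ + j.2.2)) (b j.1 (s₀ + j.2.2)) (colsBelow c n (L j.1) (s₀ + j.2.2))
        (colsBelow c n (L j.1) (s₀ + j.2.2 + 1) \ colsBelow c n (L j.1) (s₀ + j.2.2))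
        Finset.disjoint_sdiff
      rw [hun] at g1
      refine g1.trans (mul_le_mul_of_nonneg_right ?_ (Nat.cast_nonneg _))
      have g2 := sum_quarter_pow_not_disjoint_le (c := c) (L := L) (t := t) hn (by linarith) hsum
        s₀ m (colsBelow c n (L j.1) (s₀ + j.2.2 + 1))
      have g3 : Real.exp (-b j.1 (s₀ + j.2.2)) =
          Real.exp (-(τ * #(colsBelow c n (L j.1) (s₀ + j.2.2 + 1)))) *
            (1 / 4) ^ (s₀ + (j.2.2 : ℕ) + 1) := by
        simp only [hb]
        rw [neg_add, Real.exp_add]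
        congr 1
        rw [← Nat.cast_add_one, ← mul_neg, Real.exp_nat_mul, Real.exp_neg,
          Real.exp_log (by norm_num), one_div]
      -- The spare factor `1 / 4` absorbs the `2` of the two-sided tail bound.
      rw [g3, pow_succ]
      have g4 : Real.exp (-(τ * #(colsBelow c n (L j.1) (s₀ + j.2.2 + 1)))) ≤
          Real.exp (-(2 * ∑ k : U × Fin t × Fin m with ¬ Disjoint
            (colsBelow c n (L k.1) (s₀ + k.2.2 + 1)) (colsBelow c n (L j.1) (s₀ + j.2.2 + 1)),
              (1 / 4 : ℝ) ^ (s₀ + (k.2.2 : ℕ)))) := by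
        rw [Real.exp_le_exp, neg_le_neg_iff, hτ]
        linarith
      have g5 : (0 : ℝ) ≤ (1 / 4) ^ (s₀ + (j.2.2 : ℕ)) := by positivity
      have g6 := mul_le_mul_of_nonneg_left g4 g5
      have g7 := mul_nonneg g5 (Real.exp_pos (-(τ * #(colsBelow c n (L j.1) (s₀ + j.2.2 + 1))))).le
      linarith)
  have hxsum : ∑ j : U × Fin t × Fin m, (1 / 4 : ℝ) ^ (s₀ + (j.2.2 : ℕ)) ≤ Fintype.card U := by
    simp only [Fintype.sum_prod_type, Finset.sum_const, Finset.card_univ, Fintype.card_fin,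
      nsmul_eq_mul]
    refine mul_le_of_le_one_right (Nat.cast_nonneg _) ?_
    calc _ ≤ (t : ℝ) * ∑ i : Fin m, (1 / 2 : ℝ) ^ (s₀ + (i : ℕ)) := by gcongr; norm_num
      _ ≤ t * (2 * y) := by
          rw [Fin.sum_univ_eq_sum_range (fun i => (1 / 2 : ℝ) ^ (s₀ + i))]
          gcongr
          exact sum_half_pow_le' _ _
      _ ≤ t * (2 * (2 * μ)) := by gcongr
      _ ≤ 1 := by linarith
  calc _ ≤ Real.exp (-(2 * ∑ j : U × Fin t × Fin m, (1 / 4 : ℝ) ^ (s₀ + (j.2.2 : ℕ)))) *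
        Fintype.card (C → Fin t) := by gcongr
    _ ≤ _ := hlll
    _ ≤ _ := by
      refine Nat.cast_le.2 (Finset.card_le_card fun X hX => ?_)
      simp only [avoiding, hA, mem_filter, mem_univ, true_and, forall_const, not_lt] at hX ⊢
      intro u l
      have hall : ∀ e ∈ L u, c e ⊆ colsBelow c n (L u) (s₀ + m) := fun e he =>
        subset_colsBelow (by omega) he
      rw [← partialCount_eq_card _ hall, ← partialCount_empty (l := l) (L := L u) hc X, ← hempty u]
      -- The increments telescope from the plain expectation (no colour revealed) to the true count
      -- (all colours revealed).
      have htel := Finset.sum_range_sub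
        (fun i => partialCount c l (L u) (colsBelow c n (L u) (s₀ + i)) X) m
      rw [add_zero] at htel
      rw [← htel]
      refine (Finset.abs_sum_le_sum_abs _ _).trans (le_trans ?_ (hθsum u))
      exact Finset.sum_le_sum fun i hi => hX (u, l, ⟨i, Finset.mem_range.1 hi⟩)

end Stars

/-! ### Combining stars with arbitrary edge sets -/

/-- A colour assignment splitting evenly both a family of stars and a family of arbitrary edge
sets. -/
theorem exists_balanced_assignment {E C U : Type*} [Fintype E] [Fintype C] [DecidableEq C]
    [Fintype U] [DecidableEq U] [DecidableEq E] {c : E → Finset C} {n t Δ : ℕ} {L : U → Finset E}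
    {μ δ : ℝ} (hn : 0 < n) (ht : 0 < t)
    (hΔ : 0 < Δ) (hμ0 : 0 < μ) (hδ : 0 < δ) (hc : ∀ e, #(c e) = Δ) (hL : ∀ u, #(L u) ≤ 2 * n)
    (hmult : ∀ α, (multiplicity c univ α : ℝ) ≤ μ * n)
    (hstar : ∀ e, #{u | e ∈ L u} ≤ 2)
    (h1 : 1152 * Δ ^ 2 * t * μ ≤ δ ^ 2) (h2 : 51840 * Δ ^ 2 * μ ≤ δ ^ 4) (h3 : 4 * t * μ ≤ 1)
    (𝓕 : Finset (Finset E)) (h𝓕 : ∀ F ∈ 𝓕, #F ≤ 4 * n ^ 2)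
    (h4 : #𝓕 * t * (2 * Real.exp (-(δ ^ 2 * n / (8 * Δ * μ)))) <
      Real.exp (-(2 * Fintype.card U))) :
    ∃ X : C → Fin t,
      (∀ u l, |(#(assignedEdges c l (L u) X) : ℝ) - #(L u) / (t : ℝ) ^ Δ| ≤ δ * n) ∧
      ∀ F ∈ 𝓕, ∀ l, |(#(assignedEdges c l F X) : ℝ) - #F / (t : ℝ) ^ Δ| ≤ δ * n ^ 2 := by
  have hn' : (0 : ℝ) < n := by exact_mod_cast hn
  have hΔ' : (0 : ℝ) < Δ := by exact_mod_cast hΔ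
  have hmono : ∀ (F : Finset E) α, (multiplicity c F α : ℝ) ≤ μ * n := fun F α =>
    le_trans (Nat.cast_le.2 (Finset.card_le_card
      (Finset.filter_subset_filter _ (Finset.subset_univ F)))) (hmult α)
  have hsum : ∀ α, ∑ u, (multiplicity c (L u) α : ℝ) ≤ 2 * (μ * n) := by
    intro α
    have h : ∑ u, multiplicity c (L u) α ≤ 2 * multiplicity c univ α := by
      calc _ = ∑ u, ∑ e with α ∈ c e, if e ∈ L u then 1 else 0 := by
            refine Finset.sum_congr rfl fun u _ => ?_
            rw [multiplicity, ← Finset.card_filter, Finset.filter_filter]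
            congr 1
            ext e
            simp [and_comm]
        _ = ∑ e with α ∈ c e, #{u | e ∈ L u} := by
            rw [Finset.sum_comm]
            simp only [Finset.card_filter]
        _ ≤ ∑ e with α ∈ c e, 2 := Finset.sum_le_sum fun e _ => hstar e
        _ = _ := by rw [Finset.sum_const, smul_eq_mul, mul_comm]; rfl
    have h' : ∑ u, (multiplicity c (L u) α : ℝ) ≤ 2 * multiplicity c univ α := by exact_mod_cast h
    linarith [hmult α]
  have hgood := exp_mul_card_le_card_stars_balanced hn ht hΔ hμ0 hδ hc hL (fun u => hmono (L u))
    hsum h1 h2 h3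
  set good : Finset (C → Fin t) := {X | ∀ u l,
    |(#(assignedEdges c l (L u) X) : ℝ) - #(L u) / (t : ℝ) ^ Δ| ≤ δ * n} with hgooddef
  set bad : Finset E → Fin t → Finset (C → Fin t) := fun F l => {X |
    δ * n ^ 2 < |(#(assignedEdges c l F X) : ℝ) - #F / (t : ℝ) ^ Δ|} with hbaddef
  have hbad : ∀ F ∈ 𝓕, ∀ l, (#(bad F l) : ℝ) ≤
      2 * Real.exp (-(δ ^ 2 * n / (8 * Δ * μ))) * Fintype.card (C → Fin t) := by
    intro F hF l
    -- This choice makes the bounds for the variance term and the tail term both `δ * n ^ 2 / 2`.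
    have hlam : 0 < δ / (4 * Δ * μ * n) := by positivity
    refine le_trans ?_ (card_partialCount_sub_gt_le (c := c) (l := l) (L := F) hlam
      (δ ^ 2 * n / (8 * Δ * μ)) ∅ univ (Finset.disjoint_empty_left _))
    refine Nat.cast_le.2 (Finset.card_le_card fun X hX => ?_)
    simp only [hbaddef, mem_filter, mem_univ, true_and] at hX ⊢
    rw [Finset.empty_union, partialCount_empty hc,
      partialCount_eq_card _ (fun e _ => Finset.subset_univ _)]
    refine lt_of_le_of_lt ?_ hX
    have hq : ∑ α, (multiplicity c F α : ℝ) ^ 2 ≤ μ * n * (Δ * (4 * n ^ 2)) := by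
      calc _ ≤ ∑ α, μ * n * (multiplicity c F α : ℝ) := Finset.sum_le_sum fun α _ => by
            rw [sq]; gcongr; exact hmono F α
        _ = μ * n * (∑ α, multiplicity c F α : ℕ) := by push_cast; rw [Finset.mul_sum]
        _ ≤ _ := by
            rw [sum_multiplicity hc]
            push_cast
            gcongr
            exact_mod_cast h𝓕 F hF
    calc _ ≤ δ / (4 * Δ * μ * n) * (μ * n * (Δ * (4 * n ^ 2))) / 2 +
          δ ^ 2 * n / (8 * Δ * μ) / (δ / (4 * Δ * μ * n)) := by gcongr
      _ = δ * n ^ 2 := by field_simp; ring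
  have hpos : (0 : ℝ) < Fintype.card (C → Fin t) := by
    have : Nonempty (C → Fin t) := ⟨fun _ => ⟨0, ht⟩⟩
    exact_mod_cast Fintype.card_pos
  -- Union bound: the bad assignments are fewer than those balancing all stars.
  have hlt : #(𝓕.biUnion fun F => univ.biUnion fun l => bad F l) < #good := by
    have h5 : (#(𝓕.biUnion fun F => univ.biUnion fun l => bad F l) : ℝ) ≤
        #𝓕 * t * (2 * Real.exp (-(δ ^ 2 * n / (8 * Δ * μ)))) * Fintype.card (C → Fin t) := by
      calc _ ≤ ((∑ F ∈ 𝓕, ∑ l, #(bad F l) : ℕ) : ℝ) := Nat.cast_le.2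
            (Finset.card_biUnion_le.trans (Finset.sum_le_sum fun _ _ => Finset.card_biUnion_le))
        _ ≤ ∑ F ∈ 𝓕, ∑ l : Fin t,
            2 * Real.exp (-(δ ^ 2 * n / (8 * Δ * μ))) * Fintype.card (C → Fin t) := by
            push_cast
            exact Finset.sum_le_sum fun F hF => Finset.sum_le_sum fun l _ => hbad F hF l
        _ = _ := by simp; ring
    have h6 := mul_lt_mul_of_pos_right h4 hpos
    exact_mod_cast h5.trans_lt (h6.trans_le hgood)
  obtain ⟨X, hX, hX'⟩ := Finset.exists_mem_notMem_of_card_lt_card hlt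
  refine ⟨X, (Finset.mem_filter.1 hX).2, fun F hF l => ?_⟩
  by_contra hcon
  refine hX' (Finset.mem_biUnion.2 ⟨F, hF, Finset.mem_biUnion.2 ⟨l, mem_univ _, ?_⟩⟩)
  simpa [hbaddef] using hcon

/-! ### Stars, cross edges and restricted graphs -/

section Graphs

variable {V : Type*}

/-- The spanning subgraph of `G` formed by the edges satisfying `p`. -/
def restrictEdges (G : SimpleGraph V) (p : Sym2 V → Prop) : SimpleGraph V where
  Adj x y := G.Adj x y ∧ p s(x, y)
  symm := ⟨fun x _ h => ⟨h.1.symm, Sym2.eq_swap (a := x) ▸ h.2⟩⟩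
  loopless := ⟨fun _ h => G.irrefl h.1⟩

open Classical in
/-- The edges of `G` between `v` and `B`. -/
noncomputable def starEdges (G : SimpleGraph V) (v : V) (B : Finset V) : Finset (Sym2 V) :=
  {u ∈ B | G.Adj v u}.image fun u => s(v, u)

open Classical in
/-- The edges of `G` between `S` and `T`. -/
noncomputable def crossEdges (G : SimpleGraph V) (S T : Finset V) : Finset (Sym2 V) :=
  (G.interedges S T).image fun p => s(p.1, p.2)

theorem mem_starEdges {G : SimpleGraph V} {v : V} {B : Finset V} {e : Sym2 V} :
    e ∈ starEdges G v B ↔ ∃ u ∈ B, G.Adj v u ∧ s(v, u) = e := by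
  simp [starEdges, and_assoc]

theorem mem_crossEdges {G : SimpleGraph V} {S T : Finset V} {e : Sym2 V} :
    e ∈ crossEdges G S T ↔ ∃ x ∈ S, ∃ y ∈ T, G.Adj x y ∧ s(x, y) = e := by
  simp [crossEdges, SimpleGraph.mem_interedges_iff, and_assoc]

open Classical in
theorem card_starEdges (G : SimpleGraph V) (v : V) (B : Finset V) :
    #(starEdges G v B) = degInto G v B := by
  rw [starEdges, Finset.card_image_of_injective _ fun _ _ h => Sym2.congr_right.1 h, degInto]

open Classical in
theorem degInto_le_card (G : SimpleGraph V) (v : V) (B : Finset V) : degInto G v B ≤ #B := by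
  rw [degInto]
  exact Finset.card_filter_le _ _

open Classical in
theorem card_crossEdges (G : SimpleGraph V) {S T : Finset V} (h : Disjoint S T) :
    #(crossEdges G S T) = #(G.interedges S T) := by
  refine Finset.card_image_of_injOn ?_
  rintro ⟨x, y⟩ hp ⟨x', y'⟩ hp' he
  simp only [Finset.mem_coe, SimpleGraph.mem_interedges_iff] at hp hp'
  rcases Sym2.eq_iff.1 he with ⟨rfl, rfl⟩ | ⟨rfl, rfl⟩
  · rfl
  · exact absurd hp'.2.1 (Finset.disjoint_left.1 h hp.1)

theorem card_crossEdges_le (G : SimpleGraph V) (S T : Finset V) :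
    #(crossEdges G S T) ≤ #S * #T := by
  classical
  exact Finset.card_image_le.trans (Rel.card_interedges_le_mul _ _ _)

theorem density_mul (G : SimpleGraph V) {S T : Finset V} (h : Disjoint S T) :
    density G S T * (#S * #T) = #(crossEdges G S T) := by
  classical
  rw [density, SimpleGraph.edgeDensity_def, card_crossEdges G h]
  push_cast
  -- If `S` or `T` is empty, there are no cross edges and both sides vanish.
  refine div_mul_cancel_of_imp fun h0 => ?_
  have := Rel.card_interedges_le_mul G.Adj S T
  have h0' : #S * #T = 0 := by exact_mod_cast h0
  rw [h0'] at this
  exact_mod_cast Nat.le_zero.1 this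

theorem mem_starEdges_restrictEdges (G : SimpleGraph V) (p : Sym2 V → Prop) (v : V) (B : Finset V)
    (e : Sym2 V) : e ∈ starEdges (restrictEdges G p) v B ↔ e ∈ starEdges G v B ∧ p e := by
  rw [mem_starEdges, mem_starEdges]
  constructor
  · rintro ⟨u, h1, ⟨h2, h3⟩, rfl⟩
    exact ⟨⟨u, h1, h2, rfl⟩, h3⟩
  · rintro ⟨⟨u, h1, h2, rfl⟩, h3⟩
    exact ⟨u, h1, ⟨h2, h3⟩, rfl⟩

theorem mem_crossEdges_restrictEdges (G : SimpleGraph V) (p : Sym2 V → Prop) (S T : Finset V)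
    (e : Sym2 V) : e ∈ crossEdges (restrictEdges G p) S T ↔ e ∈ crossEdges G S T ∧ p e := by
  rw [mem_crossEdges, mem_crossEdges]
  constructor
  · rintro ⟨x, hx, y, hy, ⟨h2, h3⟩, rfl⟩
    exact ⟨⟨x, hx, y, hy, h2, rfl⟩, h3⟩
  · rintro ⟨⟨x, hx, y, hy, h2, rfl⟩, h3⟩
    exact ⟨x, hx, y, hy, ⟨h2, h3⟩, rfl⟩

theorem degInto_between_left (H : SimpleGraph V) {A B : Finset V} {v : V} (hv : v ∈ A) :
    degInto (H.between A B) v B = degInto H v B := by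
  rw [degInto, degInto]
  congr 1
  ext u
  simp only [mem_filter]
  exact and_congr_right fun hu => ⟨fun h => h.1, fun h => ⟨h, Or.inl ⟨hv, hu⟩⟩⟩

theorem degInto_between_right (H : SimpleGraph V) {A B : Finset V} {v : V} (hv : v ∈ B) :
    degInto (H.between A B) v A = degInto H v A := by
  rw [degInto, degInto]
  congr 1
  ext u
  simp only [mem_filter]
  exact and_congr_right fun hu => ⟨fun h => h.1, fun h => ⟨h, Or.inr ⟨hv, hu⟩⟩⟩

theorem density_between (H : SimpleGraph V) {A B S T : Finset V} (hS : S ⊆ A) (hT : T ⊆ B) :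
    density (H.between A B) S T = density H S T := by
  rw [density, density, SimpleGraph.edgeDensity_def, SimpleGraph.edgeDensity_def]
  congr 4
  ext ⟨x, y⟩
  rw [SimpleGraph.mem_interedges_iff, SimpleGraph.mem_interedges_iff]
  exact ⟨fun ⟨h1, h2, h3⟩ => ⟨h1, h2, h3.1⟩,
    fun ⟨h1, h2, h3⟩ => ⟨h1, h2, h3, Or.inl ⟨hS h1, hT h2⟩⟩⟩

end Graphs

/-! ### Padding the colours and splitting the graph -/

/-- The colour classes can be split into `t` parts such that each part spans, up to deletion of
edges, a `t ^ (-Δ)` fraction of all degrees and of all edge counts between large sets. -/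
theorem exists_balanced_partition {V C : Type*} [Fintype V] [Fintype C] {n r t Δ : ℕ} {μ δ : ℝ}
    (G : SimpleGraph V) (W : Fin r → Finset V) (c : G.edgeSet → Finset C)
    (hn : 0 < n) (hr : 0 < r) (ht : 0 < t) (hΔ : 0 < Δ) (hμ0 : 0 < μ) (hδ : 0 < δ)
    (hμn : 1 ≤ μ * n)
    (hW : ∀ v : V, ∃! i : Fin r, v ∈ W i) (hWn : ∀ i, #(W i) ≤ 2 * n)
    (hc : IsBounded G c (μ * n) Δ)
    (h1 : 1152 * Δ ^ 2 * t * μ ≤ δ ^ 2) (h2 : 51840 * Δ ^ 2 * μ ≤ δ ^ 4) (h3 : 4 * t * μ ≤ 1)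
    (h4 : 72 * Δ * r ^ 2 * t * μ ≤ δ ^ 2) :
    ∃ P : Fin t → Finset C, (∀ α, ∃! l, α ∈ P l) ∧ ∀ l, ∃ H ≤ colourSubgraph G c (P l),
      (∀ v i, |(degInto H v (W i) : ℝ) - degInto G v (W i) / (t : ℝ) ^ Δ| ≤ δ * n) ∧
      ∀ S T, Disjoint S T → #S ≤ 2 * n → #T ≤ 2 * n →
        |density H S T * (#S * #T) - density G S T * (#S * #T) / (t : ℝ) ^ Δ| ≤ δ * n ^ 2 := by
  classical
  have hn' : (0 : ℝ) < n := by exact_mod_cast hn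
  have hΔ' : (0 : ℝ) < Δ := by exact_mod_cast hΔ
  set col : Sym2 V → Finset C := fun e => if h : e ∈ G.edgeSet then c ⟨e, h⟩ else ∅ with hcol
  have hcolle : ∀ e, #(col e) ≤ Δ := fun e => by
    simp only [hcol]
    split_ifs with h
    · exact hc.2 _
    · simp
  have hD : ∀ e, ∃ D : Finset (Fin Δ), #D = Δ - #(col e) := fun e =>
    let ⟨D, _, hD⟩ := Finset.exists_subset_card_eq
      (s := (univ : Finset (Fin Δ))) (n := Δ - #(col e)) (by simp)
    ⟨D, hD⟩
  choose D hD using hD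
  -- Pad each colour set to size exactly `Δ` by new colours, each used on one edge only.
  set pad : Sym2 V → Finset (C ⊕ (Sym2 V × Fin Δ)) := fun e =>
    (col e).disjSum ({e} ×ˢ D e) with hpad
  have hpadcard : ∀ e, #(pad e) = Δ := fun e => by
    have := hcolle e
    simp only [hpad, Finset.card_disjSum, Finset.card_product, Finset.card_singleton, hD]
    omega
  have hmult : ∀ α, (multiplicity pad univ α : ℝ) ≤ μ * n := by
    rintro (α | ⟨e, i⟩)
    · refine le_trans ?_ (hc.1 α)
      rw [Set.ncard_eq_toFinset_card', multiplicity]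
      refine Nat.cast_le.2 ?_
      refine Finset.card_le_card_of_surjOn (fun e => (e : Sym2 V)) ?_
      intro e he
      simp only [hpad, hcol, Finset.coe_filter, Set.mem_ofPred_eq, mem_univ, true_and,
        Finset.inl_mem_disjSum] at he
      split_ifs at he with h
      · exact ⟨⟨e, h⟩, by simpa using he, rfl⟩
      · simp at he
    · refine le_trans ?_ hμn
      have : multiplicity pad univ (Sum.inr (e, i)) ≤ 1 := by
        rw [multiplicity, Finset.card_le_one]
        intro a ha b hb
        simp only [hpad, mem_filter, mem_univ, true_and, Finset.inr_mem_disjSum,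
          Finset.mem_product, Finset.mem_singleton] at ha hb
        exact ha.1.symm.trans hb.1
      exact_mod_cast this
  set 𝓕 : Finset (Finset (Sym2 V)) :=
    ({p : Finset V × Finset V | #p.1 ≤ 2 * n ∧ #p.2 ≤ 2 * n} : Finset _).image
      fun p => crossEdges G p.1 p.2 with h𝓕
  have hV : Fintype.card V ≤ 2 * r * n := by
    calc Fintype.card V = #(univ : Finset V) := rfl
      _ ≤ #(univ.biUnion W) := Finset.card_le_card fun v _ => by
          obtain ⟨i, hi, _⟩ := hW v
          exact Finset.mem_biUnion.2 ⟨i, mem_univ _, hi⟩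
      _ ≤ ∑ i, #(W i) := Finset.card_biUnion_le
      _ ≤ ∑ i : Fin r, 2 * n := Finset.sum_le_sum fun i _ => hWn i
      _ = 2 * r * n := by simp; ring
  have h𝓕card : (#𝓕 : ℝ) ≤ Real.exp (3 * r * n) := by
    have h5 : #𝓕 ≤ 16 ^ (r * n) := by
      calc #𝓕 ≤ Fintype.card (Finset V × Finset V) :=
            Finset.card_image_le.trans (Finset.card_filter_le _ _)
        _ = 4 ^ Fintype.card V := by
            rw [Fintype.card_prod, Fintype.card_finset, ← mul_pow]; norm_num
        _ ≤ 4 ^ (2 * r * n) := by gcongr; norm_num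
        _ = _ := by rw [mul_assoc, pow_mul]; norm_num
    have h16 : (16 : ℝ) ≤ Real.exp 3 := by
      have h6 := Real.exp_one_gt_d9
      have h7 : Real.exp 3 = Real.exp 1 ^ 3 := by rw [← Real.exp_nat_mul]; norm_num
      rw [h7]
      calc (16 : ℝ) ≤ 2.7 ^ 3 := by norm_num
        _ ≤ _ := by gcongr; linarith
    calc (#𝓕 : ℝ) ≤ 16 ^ (r * n) := by exact_mod_cast h5
      _ ≤ Real.exp 3 ^ (r * n) := by gcongr
      _ = _ := by rw [← Real.exp_nat_mul]; congr 1; push_cast; ring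
  obtain ⟨X, hX1, hX2⟩ := exists_balanced_assignment (c := pad) (n := n) (t := t) (Δ := Δ)
    (L := fun u : V × Fin r => starEdges G u.1 (W u.2)) (μ := μ) (δ := δ) hn ht hΔ hμ0 hδ
    hpadcard (fun u => (card_starEdges G _ _).le.trans ((degInto_le_card _ _ _).trans (hWn _)))
    hmult
    -- An edge `xy` lies only in the star of `x` towards the part of `y` and the star of `y` towards
    -- the part of `x`.
    (fun e => by
      induction e using Sym2.ind with
      | _ x y =>
      obtain ⟨i, hi, hi'⟩ := hW x
      obtain ⟨j, hj, hj'⟩ := hW y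
      refine (Finset.card_le_card (t := {(x, j), (y, i)}) ?_).trans Finset.card_le_two
      rintro ⟨v, k⟩ hv
      simp only [mem_filter, mem_univ, true_and, starEdges, mem_image] at hv
      obtain ⟨w, ⟨hw, -⟩, he⟩ := hv
      rcases Sym2.eq_iff.1 he with ⟨rfl, rfl⟩ | ⟨rfl, rfl⟩
      · simp [hj' k hw]
      · simp [hi' k hw])
    h1 h2 h3 𝓕
    (fun F hF => by
      simp only [h𝓕, mem_image, mem_filter, mem_univ, true_and] at hF
      obtain ⟨p, ⟨hp1, hp2⟩, rfl⟩ := hF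
      calc _ ≤ #p.1 * #p.2 := card_crossEdges_le _ _ _
        _ ≤ (2 * n) * (2 * n) := Nat.mul_le_mul hp1 hp2
        _ = _ := by ring)
    (by
      have hU : (Fintype.card (V × Fin r) : ℝ) ≤ 2 * r ^ 2 * n := by
        rw [Fintype.card_prod, Fintype.card_fin]
        have : Fintype.card V * r ≤ 2 * r * n * r := Nat.mul_le_mul_right _ hV
        calc ((Fintype.card V * r : ℕ) : ℝ) ≤ (2 * r * n * r : ℕ) := Nat.cast_le.2 this
          _ = _ := by push_cast; ring
      have hr' : (1 : ℝ) ≤ r := by exact_mod_cast hr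
      have ht' : (1 : ℝ) ≤ t := by exact_mod_cast ht
      have hn1 : (1 : ℝ) ≤ n := by exact_mod_cast hn
      -- The constant `9 = 3 + 2 + 4` pays for the number of set pairs, the factor `2 * t`, and the
      -- exponent `2 * |U| ≤ 4 * r ^ 2 * n` from the local lemma.
      have h5 : 9 * r ^ 2 * t * n ≤ δ ^ 2 * n / (8 * Δ * μ) := by
        rw [le_div_iff₀ (by positivity)]
        nlinarith
      have h2t : (t : ℝ) * 2 < Real.exp (2 * t * n) := by
        have h6 := Real.add_one_le_exp (2 * t * n : ℝ)
        have : (2 * t : ℝ) ≤ 2 * t * n := le_mul_of_one_le_right (by positivity) hn1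
        linarith
      calc (#𝓕 : ℝ) * t * (2 * Real.exp (-(δ ^ 2 * n / (8 * Δ * μ))))
          = #𝓕 * (t * 2) * Real.exp (-(δ ^ 2 * n / (8 * Δ * μ))) := by ring
        _ ≤ Real.exp (3 * r * n) * (t * 2) * Real.exp (-(9 * r ^ 2 * t * n)) := by gcongr
        _ < Real.exp (3 * r * n) * Real.exp (2 * t * n) * Real.exp (-(9 * r ^ 2 * t * n)) := by
            gcongr
        _ = Real.exp (3 * r * n + 2 * t * n - 9 * r ^ 2 * t * n) := by
            rw [← Real.exp_add, ← Real.exp_add]; ring_nf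
        _ ≤ _ := by
            rw [Real.exp_le_exp]
            have a1 : (r : ℝ) ≤ r ^ 2 * t := by nlinarith
            have a2 : (t : ℝ) ≤ r ^ 2 * t := by
              apply le_mul_of_one_le_left <;> nlinarith
            have a3 : (r ^ 2 : ℝ) ≤ r ^ 2 * t := le_mul_of_one_le_right (by positivity) ht'
            have a4 : (3 * r + 2 * t + 4 * r ^ 2 : ℝ) * n ≤ 9 * (r ^ 2 * t) * n := by
              gcongr; linarith
            linarith)
  refine ⟨fun l => {α | X (Sum.inl α) = l}, fun α => ⟨X (Sum.inl α), by simp, fun l hl => by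
    simpa [eq_comm] using hl⟩,
    fun l => ⟨restrictEdges G fun e => ∀ β ∈ pad e, X β = l, ?_, ?_, ?_⟩⟩
  -- Requiring the padding colours to lie in class `l` as well only deletes edges, so a subgraph of
  -- the colour subgraph results.
  · rintro x y ⟨hxy, h⟩
    refine ⟨hxy, fun α hα => ?_⟩
    have h' : Sum.inl α ∈ pad s(x, y) := by
      simp only [hpad, hcol, Finset.inl_mem_disjSum]
      rw [dif_pos]
      exact hα
    simpa using h _ h'
  · intro v i
    have h5 := hX1 (v, i) l
    have h6 : assignedEdges pad l (starEdges G v (W i)) X =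
        starEdges (restrictEdges G fun e => ∀ β ∈ pad e, X β = l) v (W i) := by
      ext e
      rw [mem_starEdges_restrictEdges]
      simp only [assignedEdges, mem_filter]
    rw [h6] at h5
    simpa only [card_starEdges] using h5
  · intro S T hST hS hT
    have h5 := hX2 (crossEdges G S T) (Finset.mem_image.2 ⟨(S, T), by simp [hS, hT], rfl⟩) l
    have h6 : assignedEdges pad l (crossEdges G S T) X =
        crossEdges (restrictEdges G fun e => ∀ β ∈ pad e, X β = l) S T := by
      ext e
      rw [mem_crossEdges_restrictEdges]
      simp only [assignedEdges, mem_filter]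
    rw [h6] at h5
    rwa [density_mul _ hST, density_mul _ hST]

/-! ### Transfer of regularity and degrees -/

section Transfer

variable {V : Type*} {G H : SimpleGraph V} {A B : Finset V} {n : ℕ} {ε d s : ℝ}

/-- Large sets satisfy `#S * #T ≥ 4 * ε ^ 2 * n ^ 2`, so an error of `ε ^ 3 * n ^ 2` edges shifts
the density by at most `ε / 4`. -/
theorem abs_density_sub_le (hn : 0 < n) (hε : 0 < ε) (hA : n ≤ #A) (hB : n ≤ #B)
    {S T : Finset V} (hS : 2 * ε * #A ≤ #S) (hT : 2 * ε * #B ≤ #T)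
    (h : |density H S T * (#S * #T) - density G S T * (#S * #T) * s| ≤ ε ^ 3 * n ^ 2) :
    |density H S T - density G S T * s| ≤ ε / 4 := by
  have hn' : (0 : ℝ) < n := by exact_mod_cast hn
  have hA' : (n : ℝ) ≤ #A := by exact_mod_cast hA
  have hB' : (n : ℝ) ≤ #B := by exact_mod_cast hB
  have hS' : 2 * ε * n ≤ #S := le_trans (by gcongr) hS
  have hT' : 2 * ε * n ≤ #T := le_trans (by gcongr) hT
  have hp : (2 * ε * n) * (2 * ε * n) ≤ (#S * #T : ℝ) := by gcongr
  have hp0 : (0 : ℝ) < #S * #T := lt_of_lt_of_le (by positivity) hp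
  have e : density H S T * (#S * #T) - density G S T * (#S * #T) * s =
      (density H S T - density G S T * s) * (#S * #T) := by ring
  rw [e, abs_mul, abs_of_pos hp0] at h
  refine le_of_mul_le_mul_right (h.trans ?_) hp0
  calc ε ^ 3 * n ^ 2 = ε / 4 * ((2 * ε * n) * (2 * ε * n)) := by ring
    _ ≤ _ := by gcongr

/-- Sets large for `2 * ε` are large for `ε`, and the total error `ε * s + ε / 4` is below `2 * ε`.
-/
theorem IsRegular.of_abs_density_sub_le (hs0 : 0 ≤ s) (hs1 : s ≤ 1) (hε : 0 < ε)
    (hG : IsRegular G A B ε d)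
    (h : ∀ S T, S ⊆ A → T ⊆ B → 2 * ε * #A ≤ #S → 2 * ε * #B ≤ #T →
      |density H S T - density G S T * s| ≤ ε / 4) :
    IsRegular (H.between A B) A B (2 * ε) (d * s) := by
  intro S T hSA hTB hS hT
  rw [density_between H hSA hTB]
  have h1 := abs_le.1 (h S T hSA hTB hS hT)
  have hεA : 0 ≤ ε * (#A : ℝ) := by positivity
  have hεB : 0 ≤ ε * (#B : ℝ) := by positivity
  have h2 := abs_le.1 (hG S T hSA hTB (by linarith) (by linarith))
  rw [abs_le]
  constructor <;> nlinarith

theorem IsLowerRegular.of_abs_density_sub_le (hs0 : 0 ≤ s) (hs1 : s ≤ 1) (hε : 0 < ε)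
    (hG : IsLowerRegular G A B ε d)
    (h : ∀ S T, S ⊆ A → T ⊆ B → 2 * ε * #A ≤ #S → 2 * ε * #B ≤ #T →
      |density H S T - density G S T * s| ≤ ε / 4) :
    IsLowerRegular (H.between A B) A B (2 * ε) (d * s) := by
  intro S T hSA hTB hS hT
  rw [density_between H hSA hTB]
  have h1 := abs_le.1 (h S T hSA hTB hS hT)
  have hεA : 0 ≤ ε * (#A : ℝ) := by positivity
  have hεB : 0 ≤ ε * (#B : ℝ) := by positivity
  have h2 := hG S T hSA hTB (by linarith) (by linarith)
  nlinarith

theorem two_mul_sub_le_of_abs_sub_le {x y b : ℝ} (hs0 : 0 ≤ s) (hs1 : s ≤ 1) (hε : 0 < ε)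
    (hb : 0 ≤ b) (h : |x - y * s| ≤ ε * b) (hy : (d - ε) * b ≤ y) : (d * s - 2 * ε) * b ≤ x := by
  have h1 := abs_le.1 h
  have h2 := mul_le_mul_of_nonneg_right hy hs0
  have h3 := mul_le_mul_of_nonneg_left hs1 (mul_nonneg hε.le hb)
  linarith

theorem le_two_mul_add_of_abs_sub_le {x y b : ℝ} (hs0 : 0 ≤ s) (hs1 : s ≤ 1) (hε : 0 < ε)
    (hb : 0 ≤ b) (h : |x - y * s| ≤ ε * b) (hy : y ≤ (d + ε) * b) : x ≤ (d * s + 2 * ε) * b := by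
  have h1 := abs_le.1 h
  have h2 := mul_le_mul_of_nonneg_right hy hs0
  have h3 := mul_le_mul_of_nonneg_left hs1 (mul_nonneg hε.le hb)
  linarith

theorem IsSuperRegular.of_abs_sub_le (hs0 : 0 ≤ s) (hs1 : s ≤ 1) (hε : 0 < ε)
    (hG : IsSuperRegular G A B ε d)
    (hH : IsRegular (H.between A B) A B (2 * ε) (d * s))
    (hA : ∀ v, |(degInto H v A : ℝ) - degInto G v A * s| ≤ ε * #A)
    (hB : ∀ v, |(degInto H v B : ℝ) - degInto G v B * s| ≤ ε * #B) :
    IsSuperRegular (H.between A B) A B (2 * ε) (d * s) := by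
  refine ⟨hH, fun v hv => ?_, fun v hv => ?_⟩
  · rw [degInto_between_left H hv]
    obtain ⟨h1, h2⟩ := hG.2.1 v hv
    exact ⟨two_mul_sub_le_of_abs_sub_le hs0 hs1 hε (Nat.cast_nonneg _) (hB v) h1,
      le_two_mul_add_of_abs_sub_le hs0 hs1 hε (Nat.cast_nonneg _) (hB v) h2⟩
  · rw [degInto_between_right H hv]
    obtain ⟨h1, h2⟩ := hG.2.2 v hv
    exact ⟨two_mul_sub_le_of_abs_sub_le hs0 hs1 hε (Nat.cast_nonneg _) (hA v) h1,
      le_two_mul_add_of_abs_sub_le hs0 hs1 hε (Nat.cast_nonneg _) (hA v) h2⟩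

theorem IsLowerSuperRegular.of_abs_sub_le (hs0 : 0 ≤ s) (hs1 : s ≤ 1) (hε : 0 < ε)
    (hG : IsLowerSuperRegular G A B ε d)
    (hH : IsLowerRegular (H.between A B) A B (2 * ε) (d * s))
    (hA : ∀ v, |(degInto H v A : ℝ) - degInto G v A * s| ≤ ε * #A)
    (hB : ∀ v, |(degInto H v B : ℝ) - degInto G v B * s| ≤ ε * #B) :
    IsLowerSuperRegular (H.between A B) A B (2 * ε) (d * s) := by
  refine ⟨hH, fun v hv => ?_, fun v hv => ?_⟩
  · rw [degInto_between_left H hv]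
    exact two_mul_sub_le_of_abs_sub_le hs0 hs1 hε (Nat.cast_nonneg _) (hB v) (hG.2.1 v hv)
  · rw [degInto_between_right H hv]
    exact two_mul_sub_le_of_abs_sub_le hs0 hs1 hε (Nat.cast_nonneg _) (hA v) (hG.2.2 v hv)

end Transfer

theorem between_mono {V : Type*} {H K : SimpleGraph V} (h : H ≤ K) (s t : Set V) :
    H.between s t ≤ K.between s t := fun _ _ hxy => ⟨h hxy.1, hxy.2⟩

/-! ### Hierarchy functions and constants -/

theorem isHierarchyFun_id : IsHierarchyFun id := ⟨strictMono_id.strictMonoOn _, fun _ h => h⟩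

theorem isHierarchyFun_pow_div {k : ℕ} (hk : k ≠ 0) {K : ℝ} (hK : 1 ≤ K) :
    IsHierarchyFun fun x => x ^ k / K := by
  have hK0 : 0 < K := by linarith
  refine ⟨fun x hx y _ hxy => div_lt_div_of_pos_right (pow_lt_pow_left₀ hxy hx.1.le hk) hK0,
    fun x hx => ⟨div_pos (pow_pos hx.1 _) hK0, ?_⟩⟩
  rw [div_le_one hK0]
  exact (pow_le_one₀ hx.1.le hx.2).trans hK

/-- The numerical consequences of the hierarchy. -/
theorem hierarchy_bounds {r t Δ : ℕ} {μ ε : ℝ} (hr : 0 < r) (ht : 0 < t) (hΔ : 0 < Δ)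
    (hε : ε ∈ Set.Ioc (0 : ℝ) 1) (h1 : μ ≤ (1 / r : ℝ) ^ 14 / 51840)
    (h2 : μ ≤ ε ^ 14 / 51840) (h3 : μ ≤ (1 / t : ℝ) ^ 14 / 51840)
    (h4 : μ ≤ (1 / Δ : ℝ) ^ 14 / 51840) :
    1152 * Δ ^ 2 * t * μ ≤ (ε ^ 3) ^ 2 ∧ 51840 * Δ ^ 2 * μ ≤ (ε ^ 3) ^ 4 ∧ 4 * t * μ ≤ 1 ∧
      72 * Δ * r ^ 2 * t * μ ≤ (ε ^ 3) ^ 2 := by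
  have hr' : (0 : ℝ) < r := by exact_mod_cast hr
  have ht' : (0 : ℝ) < t := by exact_mod_cast ht
  have hΔ' : (0 : ℝ) < Δ := by exact_mod_cast hΔ
  -- The minimum `z` of the four parameters replaces them all. Of `z ^ 14`, twelve factors can
  -- supply `ε ^ 12` and two cancel `Δ ^ 2`.
  obtain ⟨z, hz, hz0, hzr, hzε, hzt, hzΔ⟩ : ∃ z : ℝ, μ ≤ z ^ 14 / 51840 ∧ 0 < z ∧ z ≤ 1 / r ∧
      z ≤ ε ∧ z ≤ 1 / t ∧ z ≤ 1 / Δ := by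
    refine ⟨min (min (1 / r) ε) (min (1 / t) (1 / Δ)), ?_, ?_, ?_, ?_, ?_, ?_⟩
    · exact min_rec' (fun z : ℝ => μ ≤ z ^ 14 / 51840)
        (min_rec' (fun z : ℝ => μ ≤ z ^ 14 / 51840) h1 h2)
        (min_rec' (fun z : ℝ => μ ≤ z ^ 14 / 51840) h3 h4)
    · have := hε.1
      positivity
    · exact (min_le_left _ _).trans (min_le_left _ _)
    · exact (min_le_left _ _).trans (min_le_right _ _)
    · exact (min_le_right _ _).trans (min_le_left _ _)
    · exact (min_le_right _ _).trans (min_le_right _ _)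
  rw [le_div_iff₀ hr', mul_comm] at hzr
  rw [le_div_iff₀ ht', mul_comm] at hzt
  rw [le_div_iff₀ hΔ', mul_comm] at hzΔ
  have hz1 : z ≤ 1 := hzε.trans hε.2
  have hΔz : (Δ * z) ^ 2 ≤ 1 := pow_le_one₀ (by positivity) hzΔ
  have hrz : (r * z) ^ 2 ≤ 1 := pow_le_one₀ (by positivity) hzr
  have hp : ∀ k, z ^ k ≤ 1 := fun k => pow_le_one₀ hz0.le hz1
  refine ⟨?_, ?_, ?_, ?_⟩
  · calc 1152 * Δ ^ 2 * t * μ ≤ 1152 * Δ ^ 2 * t * (z ^ 14 / 51840) := by gcongr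
      _ = 1152 / 51840 * ((Δ * z) ^ 2 * (t * z) * z ^ 5) * z ^ 6 := by ring
      _ ≤ 1 * (1 * 1 * 1) * ε ^ 6 := by gcongr; exacts [by norm_num, hp 5]
      _ = _ := by ring
  · calc 51840 * Δ ^ 2 * μ ≤ 51840 * Δ ^ 2 * (z ^ 14 / 51840) := by gcongr
      _ = (Δ * z) ^ 2 * z ^ 12 := by ring
      _ ≤ 1 * ε ^ 12 := by gcongr
      _ = _ := by ring
  · calc 4 * t * μ ≤ 4 * t * (z ^ 14 / 51840) := by gcongr
      _ = 4 / 51840 * ((t * z) * z ^ 13) := by ring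
      _ ≤ 1 * (1 * 1) := by gcongr; exacts [by norm_num, hp 13]
      _ = _ := by ring
  · calc 72 * Δ * r ^ 2 * t * μ ≤ 72 * Δ * r ^ 2 * t * (z ^ 14 / 51840) := by gcongr
      _ = 72 / 51840 * ((Δ * z) * (r * z) ^ 2 * (t * z) * z ^ 4) * z ^ 6 := by ring
      _ ≤ 1 * (1 * 1 * 1 * 1) * ε ^ 6 := by gcongr; exacts [by norm_num, hp 4]
      _ = _ := by ring

end ColourSplitting

/-! ### Assembly -/

theorem lemma4p1 :
    ∃ f g : ℝ → ℝ, ColourSplitting.IsHierarchyFun f ∧ ColourSplitting.IsHierarchyFun g ∧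
    ∀ (n r t Δ : ℕ) (μ ε d : ℝ),
      0 < n → 0 < r → 0 < t → 0 < Δ →
      μ ∈ Set.Ioc (0 : ℝ) 1 → ε ∈ Set.Ioc (0 : ℝ) 1 → d ∈ Set.Ioc (0 : ℝ) 1 →
      1 / (n : ℝ) ≤ f μ →
      μ ≤ g (1 / (r : ℝ)) → μ ≤ g ε → μ ≤ g (1 / (t : ℝ)) → μ ≤ g d → μ ≤ g (1 / (Δ : ℝ)) →
    ∀ (V : Type*) [Fintype V] (C : Type*) [Fintype C]
      (G : SimpleGraph V) (W : Fin r → Finset V) (R R_S : SimpleGraph (Fin r))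
      (c : G.edgeSet → Finset C),
      (∀ v : V, ∃! i : Fin r, v ∈ W i) →
      R_S ≤ R →
      (∀ i : Fin r, n ≤ (W i).card ∧ (W i).card ≤ 2 * n) →
      ColourSplitting.IsBounded G c (μ * (n : ℝ)) Δ →
      (Fintype.card C : ℝ) ≤ μ ^ (-1.3 : ℝ) * (n : ℝ) →
      ((∀ i j : Fin r, R.Adj i j → ColourSplitting.IsRegular G (W i) (W j) ε d) →
        (∀ i j : Fin r, R_S.Adj i j → ColourSplitting.IsSuperRegular G (W i) (W j) ε d) →
        ∃ P : Fin t → Finset C, (∀ α : C, ∃! l : Fin t, α ∈ P l) ∧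
          ∀ (l : Fin t) (i j : Fin r), R.Adj i j →
            ∃ H : SimpleGraph V,
              H ≤ (ColourSplitting.colourSubgraph G c (P l)).between (W i) (W j) ∧
              ColourSplitting.IsRegular H (W i) (W j) (2 * ε) (d / (t : ℝ) ^ Δ) ∧
              (R_S.Adj i j →
                ColourSplitting.IsSuperRegular H (W i) (W j) (2 * ε) (d / (t : ℝ) ^ Δ))) ∧
      ((∀ i j : Fin r, R.Adj i j → ColourSplitting.IsLowerRegular G (W i) (W j) ε d) →
        (∀ i j : Fin r, R_S.Adj i j → ColourSplitting.IsLowerSuperRegular G (W i) (W j) ε d) →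
        ∃ P : Fin t → Finset C, (∀ α : C, ∃! l : Fin t, α ∈ P l) ∧
          ∀ (l : Fin t) (i j : Fin r), R.Adj i j →
            ∃ H : SimpleGraph V,
              H ≤ (ColourSplitting.colourSubgraph G c (P l)).between (W i) (W j) ∧
              ColourSplitting.IsLowerRegular H (W i) (W j) (2 * ε) (d / (t : ℝ) ^ Δ) ∧
              (R_S.Adj i j →
                ColourSplitting.IsLowerSuperRegular H (W i) (W j) (2 * ε) (d / (t : ℝ) ^ Δ))) := by
  -- Taking `f = id` gives `1 ≤ μ * n`, which lets each padding colour occupy one edge.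
  refine ⟨id, fun x => x ^ 14 / 51840, ColourSplitting.isHierarchyFun_id,
    ColourSplitting.isHierarchyFun_pow_div (by norm_num) (by norm_num), ?_⟩
  intro n r t Δ μ ε d hn hr ht hΔ hμ hε hd hnμ hμr hμε hμt hμd hμΔ V _ C _ G W R R_S c hW hRS hWn
    hc hC
  obtain ⟨hε0, -⟩ := id hε
  have hn' : (0 : ℝ) < n := by exact_mod_cast hn
  obtain ⟨h1, h2, h3, h4⟩ := ColourSplitting.hierarchy_bounds hr ht hΔ hε hμr hμε hμt hμΔ
  -- The choice `δ = ε ^ 3` leaves room for division by `4 * ε ^ 2`, the least relative size of a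
  -- pair of large sets.
  obtain ⟨P, hP, hH⟩ := ColourSplitting.exists_balanced_partition (δ := ε ^ 3) G W c hn hr ht hΔ
    hμ.1 (by positivity) ((div_le_iff₀ hn').1 hnμ) hW (fun i => (hWn i).2) hc h1 h2 h3 h4
  choose H hHle hdeg hdens using hH
  set s : ℝ := ((t : ℝ) ^ Δ)⁻¹ with hs
  simp only [div_eq_mul_inv, ← hs] at hdeg hdens ⊢
  have ht' : (1 : ℝ) ≤ (t : ℝ) ^ Δ := one_le_pow₀ (by exact_mod_cast ht)
  have hs0 : 0 ≤ s := by positivity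
  have hs1 : s ≤ 1 := inv_le_one_of_one_le₀ ht'
  have hdeg' : ∀ l v i, |(ColourSplitting.degInto (H l) v (W i) : ℝ) -
      ColourSplitting.degInto G v (W i) * s| ≤ ε * (W i).card := fun l v i => by
    refine (hdeg l v i).trans ?_
    have h5 : (n : ℝ) ≤ (W i).card := by exact_mod_cast (hWn i).1
    have h6 : ε ^ 3 ≤ ε := pow_le_of_le_one hε.1.le hε.2 (by norm_num)
    gcongr
  have hdens' : ∀ l i j, R.Adj i j → ∀ S T, S ⊆ W i → T ⊆ W j → 2 * ε * (W i).card ≤ S.card →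
      2 * ε * (W j).card ≤ T.card →
      |ColourSplitting.density (H l) S T - ColourSplitting.density G S T * s| ≤ ε / 4 := by
    intro l i j hij S T hS hT hSc hTc
    refine ColourSplitting.abs_density_sub_le hn hε0 (hWn i).1 (hWn j).1 hSc hTc
      (hdens l S T ?_ ((Finset.card_le_card hS).trans (hWn i).2)
        ((Finset.card_le_card hT).trans (hWn j).2))
    exact Finset.disjoint_left.2 fun v hvS hvT => hij.ne ((hW v).unique (hS hvS) (hT hvT))
  constructor
  · intro hreg hsup
    refine ⟨P, hP, fun l i j hij => ⟨(H l).between (W i) (W j),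
      ColourSplitting.between_mono (hHle l) _ _, ?_⟩⟩
    have hR := (hreg i j hij).of_abs_density_sub_le hs0 hs1 hε0 (hdens' l i j hij)
    exact ⟨hR, fun hij' => (hsup i j hij').of_abs_sub_le hs0 hs1 hε0 hR
      (fun v => hdeg' l v i) fun v => hdeg' l v j⟩
  · intro hreg hsup
    refine ⟨P, hP, fun l i j hij => ⟨(H l).between (W i) (W j),
      ColourSplitting.between_mono (hHle l) _ _, ?_⟩⟩
    have hR := (hreg i j hij).of_abs_density_sub_le hs0 hs1 hε0 (hdens' l i j hij)
    exact ⟨hR, fun hij' => (hsup i j hij').of_abs_sub_le hs0 hs1 hε0 hR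
      (fun v => hdeg' l v i) fun v => hdeg' l v j⟩
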